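/- For $1\le p\le\infty$, $\delta\ge0$ and $v=(v(n))_{n\in\mathbb Z}\subset\mathbb C$ let $\|v\|_{\ell^{p,\delta}}=\big(\sum_n|v(n)|^pe^{\delta|n|p}\big)^{1/p}$ (for $p=\infty$: $\sup_n|v(n)|e^{\delta|n|}$), and, in terms of Fourier sequences, let $$B^\delta_{\varepsilon,C}=\{v:\ \|v\|_{\ell^{p,\delta}}\le C\varepsilon^{\frac12-\frac1p}\ \text{ for all } p\in[1,\infty]\}.$$ Let $$F_1(v)=\sum\frac{v(m_1)v(m_2)\bar v(m_3)\bar v(m_4)}{m_1^2+m_2^2-m_3^2-m_4^2},$$ summed over integers with $m_1+m_2-m_3-m_4=0$ and nonzero denominator, and $$F_2(v)=\sum\frac{v(m_1)v(m_2)v(m_3)\bar v(m_4)\bar v(m_5)\bar v(m_6)}{q(m)(m_2-m_6)(m_6-m_3)}-\text{c.c.},$$ summed over integers with $m_4,m_5\ne m_1$, $m_2,m_3\ne m_6$, $m_1+m_2+m_3-m_4-m_5-m_6=0$ and $q(m):=m_1^2+m_2^2+m_3^2-m_4^2-m_5^2-m_6^2\ne0$. Let $X_F^1$ be the time-$1$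 map of the Hamiltonian flow $\frac{dw(n)}{ds}=\frac{\partial F}{\partial\bar w(n)}$ on $\ell^1(\mathbb Z)$ (defined at $v$ if the solution in $C([0,1];\ell^1)$ with $w(0)=v$ exists), and let $u=u(v)=X^1_{F_1}\big(X^1_{F_2}(v)\big)$. The partially defined transformation $v\mapsto u$ is single-valued and injective, and $\|u\|_{\ell^2}=\|v\|_{\ell^2}$ whenever $u=u(v)$. Moreover, for every $C>0$ there is $\varepsilon_0=\varepsilon_0(C)\in(0,1)$ such that for all $\delta>0$ and $0<\varepsilon<\varepsilon_0$: (a) $u(v)$ is defined for every $v\in B^\delta_{\varepsilon,C}$, and every $u\in B^\delta_{\varepsilon,C}$ equals $u(v)$ for some $v$; (b) for every $p\in[1,\infty]$ and $\gamma>0$ there is a constant $K=K(C,p,\gamma)$, independent of $\delta$ and of $\varepsilon$, such that if $u=u(v)$ and $u\in B^\delta_{\varepsilon,C}$ or $v\in B^\delta_{\varepsilon,C}$, then $$\|u-v\|_{\ell^{p,\delta}}\le K\,\varepsilon^{\frac32-\frac1p-\gamma};$$ (c) if $u=u(v)$, then $u\in B^\delta_{\varepsilon,C}$ implies $v\in B^\delta_{\varepsilon,2C}$,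 and $v\in B^\delta_{\varepsilon,C}$ implies $u\in B^\delta_{\varepsilon,2C}$. -/

import Mathlib

open scoped ENNReal ComplexConjugate

noncomputable section

namespace QuasiLinearNLS

/-- The weighted norm `‖v‖_{ℓ^{p,δ}} = (∑ₙ |v(n)|^p e^{δ|n|p})^{1/p}` (a supremum for `p = ∞`) of a
sequence `v : ℤ → ℂ`, as an extended nonnegative real. For `δ = 0` it is the usual `ℓ^p` norm. -/
def ellNorm (p : ℝ≥0∞) (δ : ℝ) (v : ℤ → ℂ) : ℝ≥0∞ :=
  MeasureTheory.eLpNorm (fun n : ℤ => ((Real.exp (δ * |(n : ℝ)|) : ℝ) : ℂ) * v n) p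
    MeasureTheory.Measure.count

/-- The set `B^δ_{ε,C}`, in terms of sequences of Fourier coefficients:
`‖v‖_{ℓ^{p,δ}} ≤ C ε^{1/2 - 1/p}` for all `1 ≤ p ≤ ∞`. Such sequences lie in `ℓ²` (take `p = 2`). -/
def B (δ ε C : ℝ) : Set (ℤ → ℂ) :=
  {v | ∀ p : ℝ≥0∞, 1 ≤ p →
    ellNorm p δ v ≤ ENNReal.ofReal (C * ε ^ ((1 / 2 : ℝ) - (p⁻¹).toReal))}

/-- The term with index `(m₁, m₂, m₃, m₄)` of the quartic Hamiltonian `F₁`. -/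
def quarticTerm (v : ℤ → ℂ) : ℤ × ℤ × ℤ × ℤ → ℂ
  | (m₁, m₂, m₃, m₄) =>
    if m₁ + m₂ - m₃ - m₄ = 0 ∧ m₁ ^ 2 + m₂ ^ 2 - m₃ ^ 2 - m₄ ^ 2 ≠ 0 then
      v m₁ * v m₂ * conj (v m₃) * conj (v m₄)
        / ((m₁ ^ 2 + m₂ ^ 2 - m₃ ^ 2 - m₄ ^ 2 : ℤ) : ℂ)
    else 0

/-- The quartic Hamiltonian
`F₁(v) = ∑ v(m₁) v(m₂) v̄(m₃) v̄(m₄) / (m₁² + m₂² - m₃² - m₄²)`, the sum over all integers with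
`m₁ + m₂ - m₃ - m₄ = 0` and nonvanishing denominator. It converges absolutely for `v ∈ ℓ¹`. -/
def F₁ (v : ℤ → ℂ) : ℂ := ∑' m : ℤ × ℤ × ℤ × ℤ, quarticTerm v m

/-- The term with index `(m₁, …, m₆)` of the sum that defines the sextic Hamiltonian `F₂`. -/
def sexticTerm (v : ℤ → ℂ) : ℤ × ℤ × ℤ × ℤ × ℤ × ℤ → ℂ
  | (m₁, m₂, m₃, m₄, m₅, m₆) =>
    if (m₄ ≠ m₁ ∧ m₅ ≠ m₁ ∧ m₂ ≠ m₆ ∧ m₃ ≠ m₆) ∧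
        m₁ + m₂ + m₃ - m₄ - m₅ - m₆ = 0 ∧
        m₁ ^ 2 + m₂ ^ 2 + m₃ ^ 2 - m₄ ^ 2 - m₅ ^ 2 - m₆ ^ 2 ≠ 0 then
      v m₁ * v m₂ * v m₃ * conj (v m₄) * conj (v m₅) * conj (v m₆)
        / (((m₁ ^ 2 + m₂ ^ 2 + m₃ ^ 2 - m₄ ^ 2 - m₅ ^ 2 - m₆ ^ 2)
            * (m₂ - m₆) * (m₆ - m₃) : ℤ) : ℂ)
    else 0

/-- The sextic Hamiltonian
`F₂(v) = ∑ v(m₁) v(m₂) v(m₃) v̄(m₄) v̄(m₅) v̄(m₆) / (q(m) (m₂ - m₆) (m₆ - m₃)) - c.c.`,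
the sum over `m₄, m₅ ≠ m₁`, `m₂, m₃ ≠ m₆`, `l(m) = 0`, `q(m) ≠ 0`, where
`l(m) = m₁ + m₂ + m₃ - m₄ - m₅ - m₆` and `q(m) = m₁² + m₂² + m₃² - m₄² - m₅² - m₆²`.
It converges absolutely for `v ∈ ℓ¹`. -/
def F₂ (v : ℤ → ℂ) : ℂ :=
  (∑' m : ℤ × ℤ × ℤ × ℤ × ℤ × ℤ, sexticTerm v m)
    - conj (∑' m : ℤ × ℤ × ℤ × ℤ × ℤ × ℤ, sexticTerm v m)

/-- The Wirtinger derivative `∂F/∂w̄(n) = (∂F/∂x(n) + i ∂F/∂y(n)) / 2` at `w`, where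
`w(n) = x(n) + i y(n)`. (`F₁` and `F₂` are, at each `w ∈ ℓ¹`, polynomials in `x(n)`, `y(n)` for each
fixed `n`, so the partial derivatives exist there.) -/
def dbar (F : (ℤ → ℂ) → ℂ) (w : ℤ → ℂ) (n : ℤ) : ℂ :=
  (deriv (fun t : ℝ => F (w + Pi.single n (t : ℂ))) 0
    + Complex.I * deriv (fun t : ℝ => F (w + Pi.single n ((t : ℂ) * Complex.I))) 0) / 2

/-- `TimeOne F v u`: the time-one map `X_F^1` of the Hamiltonian flow of `F` is defined at `v`, with
value `u`. That is, `u = w(1)` for a solution of `dw(n)/ds = ∂F/∂w̄(n)`, `w(0) = v`, on `0 ≤ s ≤ 1`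
that is a continuous curve in the phase space `ℓ¹`. -/
def TimeOne (F : (ℤ → ℂ) → ℂ) (v u : ℤ → ℂ) : Prop :=
  ∃ w : ℝ → lp (fun _ : ℤ => ℂ) 1,
    ContinuousOn w (Set.Icc 0 1) ∧
    ⇑(w 0) = v ∧ ⇑(w 1) = u ∧
    ∀ s ∈ Set.Icc (0 : ℝ) 1, ∀ n : ℤ,
      HasDerivWithinAt (fun s' : ℝ => (w s' : ℤ → ℂ) n) (dbar F (⇑(w s)) n) (Set.Icc 0 1) s

/-- `Canonical v u`: the canonical transformation `u = u(v) = (X_{F₁}^1 ∘ X_{F₂}^1)(v)` is defined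
at `v`, with value `u`. -/
def Canonical (v u : ℤ → ℂ) : Prop :=
  ∃ z : ℤ → ℂ, TimeOne F₂ v z ∧ TimeOne F₁ z u

end QuasiLinearNLS

end

open scoped ENNReal ComplexConjugate

noncomputable section

namespace QuasiLinearNLS

/-! ### Sums of products of extended nonnegative reals -/

/-! Membership in `B δ ε C` is equivalent, by interpolation, to its cases `p = 1` and `p = ∞`
(`mem_B_iff`): with `l = √ε`, the weighted sequence has sum at most `C / l` and supremum at most `C
l`. Everything rests on one estimate (`IsCoeff.exists_field_bound`): on such sequences each
Hamiltonian vector field is smaller by a factor `ε^(1-γ)`, uniformly in `δ`.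

The estimate is a count. On the hyperplane of vanishing signed sum the denominators factor into
integers, so a power `r > 1` of a coefficient is summable once `p + 1` suitable indices are fixed
(`Dispersive`; `p = 0` for the quartic, `p = 1` for the sextic form). Those indices are paid for by
sums and all others by suprema, which yields the gain `l ^ 2 = ε`. The coefficients themselves decay
only to the power one; `enorm_le_rpow_add` exchanges them for their powers `r` at the cost of
`ε^(-γ)`. The weight `e^{δ|n|}` is harmless because the output index is at most the sum of the input
indices in absolute value.

In the norm `max (l ‖w‖₁) (‖w‖_∞ / l)` of `TwoNorm` the bound says that the field is small on balls.
Picard–Lindelöf then solves the weighted flow up to time one, forwards or backwards, and the mean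
value inequality bounds the displacement. Local Lipschitz continuity on `ℓ¹` gives uniqueness, hence
single-valuedness and injectivity, and identifies an arbitrary solution with the confined one. The
`ℓ²` norm is conserved because each Hamiltonian has equally many conjugated and unconjugated
factors. -/

theorem tsum_pi_prod {n : ℕ} (f : Fin n → ℤ → ℝ≥0∞) :
    ∑' y : Fin n → ℤ, ∏ i, f i (y i) = ∏ i, ∑' x, f i x := by
  induction n with
  | zero => simp [tsum_fintype]
  | succ n ih =>
    rw [← (Fin.consEquiv fun _ : Fin (n + 1) => ℤ).tsum_eq, ENNReal.tsum_prod']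
    simp only [Fin.consEquiv, Equiv.coe_fn_mk, Fin.prod_univ_succ, Fin.cons_zero, Fin.cons_succ,
      ENNReal.tsum_mul_left, ENNReal.tsum_mul_right, ih fun i => f i.succ]

theorem tsum_insertNth {n : ℕ} (j : Fin (n + 1)) (f : (Fin (n + 1) → ℤ) → ℝ≥0∞) :
    ∑' (x : ℤ) (y : Fin n → ℤ), f (j.insertNth x y) = ∑' m, f m := by
  rw [← (Fin.insertNthEquiv (fun _ : Fin (n + 1) => ℤ) j).tsum_eq, ENNReal.tsum_prod']
  simp [Fin.insertNthEquiv]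

theorem tsum_le_tsum_of_injOn {α β : Type*} {w : α → ℝ≥0∞} {G : β → ℝ≥0∞} (φ : α → β)
    (hinj : Set.InjOn φ (Function.support w)) (hle : ∀ m ∈ Function.support w, w m ≤ G (φ m)) :
    ∑' m, w m ≤ ∑' b, G b := by
  rw [← tsum_subtype_support w]
  calc ∑' m : Function.support w, w m ≤ ∑' m : Function.support w, G (φ m) :=
        ENNReal.tsum_le_tsum fun m => hle m m.2
    _ ≤ ∑' b, G b := ENNReal.tsum_comp_le_tsum_of_injective
        (f := fun m : Function.support w => φ m) (Set.injOn_iff_injective.1 hinj) G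

/-! ### Weights with controlled sums -/

/-- Summing the weight `w` against functions of the variables in `Z` costs at most their sums. -/
def SumControlled {N : ℕ} (w : (Fin N → ℤ) → ℝ≥0∞) (Z : Finset (Fin N)) (K : ℝ≥0∞) : Prop :=
  ∀ g : Fin N → ℤ → ℝ≥0∞, ∑' m, w m * ∏ i ∈ Z, g i (m i) ≤ K * ∏ i ∈ Z, ∑' x, g i x

/-- Used for the `ℓ¹` norm of the field. The output slot `j` lies outside `Z`, so all of `Z`
consists of inputs, paid for by sums; each of the remaining inputs is replaced by the supremum. -/
theorem SumControlled.tsum_le {n : ℕ} {w : (Fin (n + 1) → ℤ) → ℝ≥0∞} {Z : Finset (Fin (n + 1))}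
    {K : ℝ≥0∞} (h : SumControlled w Z K) {j : Fin (n + 1)} (hj : j ∉ Z) {f : ℤ → ℝ≥0∞}
    {a b : ℝ≥0∞} (ha : ∑' x, f x ≤ a) (hb : ∀ x, f x ≤ b) :
    ∑' (x : ℤ) (y : Fin n → ℤ), w (j.insertNth x y) * ∏ i, f (y i)
      ≤ K * a ^ Z.card * b ^ (n - Z.card) := by
  have key : ∀ m : Fin (n + 1) → ℤ, w m * ∏ i, f (m (j.succAbove i))
      ≤ (w m * ∏ i ∈ Z, f (m i)) * b ^ (n - Z.card) := by
    intro m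
    have e : ∏ i, f (m (j.succAbove i)) = ∏ i ∈ {j}ᶜ, f (m i) := by
      rw [← Fin.image_succAbove_univ, Finset.prod_image]
      exact fun _ _ _ _ h => Fin.succAbove_right_injective h
    have hsub : Z ⊆ {j}ᶜ := fun i hi => by
      simp only [Finset.mem_compl, Finset.mem_singleton]; rintro rfl; exact hj hi
    rw [e, ← Finset.prod_sdiff hsub, mul_comm (∏ i ∈ _ \ _, _), ← mul_assoc]
    gcongr
    refine (Finset.prod_le_prod' fun i _ => hb _).trans_eq ?_
    rw [Finset.prod_const, Finset.card_sdiff_of_subset hsub, Finset.card_compl]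
    simp
  calc _ = ∑' m, w m * ∏ i, f (m (j.succAbove i)) := by
        rw [← tsum_insertNth j]; simp
    _ ≤ ∑' m, (w m * ∏ i ∈ Z, f (m i)) * b ^ (n - Z.card) := ENNReal.tsum_le_tsum key
    _ ≤ K * a ^ Z.card * b ^ (n - Z.card) := by
        rw [ENNReal.tsum_mul_right]
        gcongr
        refine (h fun _ => f).trans ?_
        rw [Finset.prod_const]
        gcongr

/-- Used for the supremum of the field. Freezing the output at `x` amounts to putting a unit mass at
`x` into slot `j`; its sum is `1`, so one of the factors of `Z` costs nothing. -/
theorem SumControlled.tsum_le_of_mem {n : ℕ} {w : (Fin (n + 1) → ℤ) → ℝ≥0∞}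
    {Z : Finset (Fin (n + 1))} {K : ℝ≥0∞} (h : SumControlled w Z K) {j : Fin (n + 1)} (hj : j ∈ Z)
    {f : ℤ → ℝ≥0∞} {a b : ℝ≥0∞} (ha : ∑' x, f x ≤ a) (hb : ∀ x, f x ≤ b) (x : ℤ) :
    ∑' y : Fin n → ℤ, w (j.insertNth x y) * ∏ i, f (y i)
      ≤ K * a ^ (Z.card - 1) * b ^ (n + 1 - Z.card) := by
  set e : ℤ → ℝ≥0∞ := Pi.single x 1 with he
  have hsum : ∑' x', e x' = 1 := by simp [he]
  have key : ∀ m : Fin (n + 1) → ℤ, w m * (e (m j) * ∏ i, f (m (j.succAbove i)))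
      ≤ (w m * ∏ i ∈ Z, (if i = j then e else f) (m i)) * b ^ (n + 1 - Z.card) := by
    intro m
    have e1 : e (m j) * ∏ i, f (m (j.succAbove i)) = ∏ i, (if i = j then e else f) (m i) := by
      rw [Fin.prod_univ_succAbove _ j]; simp [Fin.succAbove_ne]
    rw [e1, ← Finset.prod_sdiff (Finset.subset_univ Z), mul_comm (∏ i ∈ _ \ _, _), ← mul_assoc]
    gcongr
    calc _ ≤ ∏ i ∈ Finset.univ \ Z, b := Finset.prod_le_prod' fun i hi => by
          rw [if_neg]
          · exact hb _
          · rintro rfl; simp [hj] at hi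
      _ = _ := by
        rw [Finset.prod_const, Finset.card_sdiff_of_subset (Finset.subset_univ _)]; simp
  calc _ = ∑' (x' : ℤ) (y : Fin n → ℤ), w (j.insertNth x' y) * (e x' * ∏ i, f (y i)) := by
        rw [tsum_eq_single x]
        · simp [he]
        · intro x' hx'; simp [he, hx']
    _ = ∑' m, w m * (e (m j) * ∏ i, f (m (j.succAbove i))) := by
        rw [← tsum_insertNth j]; simp
    _ ≤ ∑' m, (w m * ∏ i ∈ Z, (if i = j then e else f) (m i)) * b ^ (n + 1 - Z.card) :=
        ENNReal.tsum_le_tsum key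
    _ ≤ K * a ^ (Z.card - 1) * b ^ (n + 1 - Z.card) := by
        rw [ENNReal.tsum_mul_right]
        gcongr
        refine (h fun i => if i = j then e else f).trans ?_
        gcongr
        rw [← Finset.mul_prod_erase Z _ hj, if_pos rfl, hsum, one_mul,
          ← Finset.card_erase_of_mem hj, ← Finset.prod_const]
        refine Finset.prod_le_prod' fun i hi => ?_
        rw [if_neg (Finset.ne_of_mem_erase hi)]
        exact ha

/-- The summable weight `|k|^{-r}` (with value `0` at `k = 0`). -/
def decay (r : ℝ) (k : ℤ) : ℝ≥0∞ := ENNReal.ofReal (|(k : ℝ)| ^ (-r))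

theorem tsum_decay_lt_top {r : ℝ} (hr : 1 < r) : ∑' k, decay r k < ∞ := by
  unfold decay
  rw [← ENNReal.ofReal_tsum_of_nonneg (fun _ => by positivity) (Real.summable_abs_int_rpow hr)]
  exact ENNReal.ofReal_lt_top

theorem enorm_rpow_le_decay {r t : ℝ} (hr : 0 < r) {k : ℤ} (h : |t| ≤ |(k : ℝ)|⁻¹) :
    ‖t‖ₑ ^ r ≤ decay r k := by
  rw [decay, Real.rpow_neg (abs_nonneg _), ← Real.inv_rpow (abs_nonneg _),
    Real.enorm_eq_ofReal_abs, ENNReal.ofReal_rpow_of_nonneg (abs_nonneg _) hr.le]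
  exact ENNReal.ofReal_le_ofReal (Real.rpow_le_rpow (abs_nonneg _) h hr.le)

theorem decay_mul {r : ℝ} (k l : ℤ) : decay r (k * l) = decay r k * decay r l := by
  simp only [decay]
  rw [← ENNReal.ofReal_mul (by positivity), ← Real.mul_rpow (abs_nonneg _) (abs_nonneg _)]
  push_cast
  rw [abs_mul]

/-! ### The coefficients of the two Hamiltonians -/

/-- The coefficients of `F₁`, halved. -/
def quarticCoeff (m : Fin 4 → ℤ) : ℝ :=
  if m 0 + m 1 - m 2 - m 3 = 0 ∧ m 0 ^ 2 + m 1 ^ 2 - m 2 ^ 2 - m 3 ^ 2 ≠ 0 then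
    (2 * ((m 0 ^ 2 + m 1 ^ 2 - m 2 ^ 2 - m 3 ^ 2 : ℤ) : ℝ))⁻¹
  else 0

/-- The coefficients of the sum that defines `F₂`. -/
def sexticCoeff (m : Fin 6 → ℤ) : ℝ :=
  if (m 3 ≠ m 0 ∧ m 4 ≠ m 0 ∧ m 1 ≠ m 5 ∧ m 2 ≠ m 5) ∧
      m 0 + m 1 + m 2 - m 3 - m 4 - m 5 = 0 ∧
      m 0 ^ 2 + m 1 ^ 2 + m 2 ^ 2 - m 3 ^ 2 - m 4 ^ 2 - m 5 ^ 2 ≠ 0 then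
    (((m 0 ^ 2 + m 1 ^ 2 + m 2 ^ 2 - m 3 ^ 2 - m 4 ^ 2 - m 5 ^ 2)
      * (m 1 - m 5) * (m 5 - m 2) : ℤ) : ℝ)⁻¹
  else 0

theorem abs_inv_intCast_le_one (k : ℤ) : |((k : ℝ))⁻¹| ≤ 1 := by
  rw [abs_inv]
  rcases eq_or_ne k 0 with rfl | hk
  · simp
  · exact inv_le_one_of_one_le₀ (by exact_mod_cast Int.one_le_abs hk)

theorem abs_quarticCoeff_le_one (m : Fin 4 → ℤ) : |quarticCoeff m| ≤ 1 := by
  unfold quarticCoeff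
  split_ifs
  · have := abs_inv_intCast_le_one (2 * (m 0 ^ 2 + m 1 ^ 2 - m 2 ^ 2 - m 3 ^ 2))
    rwa [Int.cast_mul, Int.cast_ofNat] at this
  · simp

theorem abs_sexticCoeff_le_one (m : Fin 6 → ℤ) : |sexticCoeff m| ≤ 1 := by
  unfold sexticCoeff
  split_ifs
  · exact abs_inv_intCast_le_one _
  · simp

/-- On the hyperplane the denominator is a constant times the product of the two differences. -/
theorem enorm_quarticCoeff_rpow_le {r : ℝ} (hr : 0 < r) (m : Fin 4 → ℤ) :
    ‖quarticCoeff m‖ₑ ^ r ≤ decay r (m 2 - m 0) * decay r (m 2 - m 1) := by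
  rw [← decay_mul]
  apply enorm_rpow_le_decay hr
  unfold quarticCoeff
  split_ifs with h
  · have e : m 0 ^ 2 + m 1 ^ 2 - m 2 ^ 2 - m 3 ^ 2 = -2 * ((m 2 - m 0) * (m 2 - m 1)) := by
      linear_combination (m 3 + (m 0 + m 1 - m 2)) * h.1
    rw [abs_inv, e]
    apply inv_anti₀
    · have : (m 2 - m 0) * (m 2 - m 1) ≠ 0 := fun h0 => h.2 (by rw [e, h0, mul_zero])
      exact abs_pos.2 (by exact_mod_cast this)
    · rw [abs_mul, Int.cast_mul (-2), abs_mul ((-2 : ℤ) : ℝ)]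
      norm_num
      linarith [mul_nonneg (abs_nonneg ((m 2 : ℝ) - m 0)) (abs_nonneg ((m 2 : ℝ) - m 1))]
  · rw [abs_zero]; positivity

/-- On the hyperplane `q(m)` is twice the difference of two products, `P` below; together with the
two explicit factors this makes three nonzero integers. -/
theorem enorm_sexticCoeff_rpow_le {r : ℝ} (hr : 0 < r) (m : Fin 6 → ℤ) :
    ‖sexticCoeff m‖ₑ ^ r ≤ decay r (m 5 - m 1) * decay r (m 5 - m 2) *
      decay r ((m 0 - m 3) * (m 0 - m 4) - (m 5 - m 1) * (m 5 - m 2)) := by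
  rw [← decay_mul, ← decay_mul]
  apply enorm_rpow_le_decay hr
  unfold sexticCoeff
  split_ifs with h
  · obtain ⟨h0, hl, hq⟩ := h
    set D := m 5 - m 1
    set E := m 5 - m 2
    set P := (m 0 - m 3) * (m 0 - m 4) - D * E with hP
    have e : (m 0 ^ 2 + m 1 ^ 2 + m 2 ^ 2 - m 3 ^ 2 - m 4 ^ 2 - m 5 ^ 2)
        * (m 1 - m 5) * (m 5 - m 2) = -2 * (D * E * P) := by
      linear_combination
        (m 1 + m 2 - m 5 + m 3 + m 4 - m 0) * (m 1 - m 5) * (m 5 - m 2) * hl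
    have hne : D * E * P ≠ 0 := fun h1 => by
      rw [h1, mul_zero] at e
      have h2 : m 1 - m 5 ≠ 0 := sub_ne_zero.2 h0.2.2.1
      have h3 : m 5 - m 2 ≠ 0 := sub_ne_zero.2 h0.2.2.2.symm
      exact mul_ne_zero (mul_ne_zero hq h2) h3 e
    rw [abs_inv, e]
    apply inv_anti₀
    · exact abs_pos.2 (by exact_mod_cast hne)
    · rw [Int.cast_mul, abs_mul]
      norm_num
      linarith [mul_nonneg (mul_nonneg (abs_nonneg (D : ℝ)) (abs_nonneg (E : ℝ)))
        (abs_nonneg (P : ℝ))]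
  · rw [abs_zero]; positivity

theorem quarticCoeff_ne_zero {m : Fin 4 → ℤ} (h : quarticCoeff m ≠ 0) :
    m 0 + m 1 - m 2 - m 3 = 0 := by
  unfold quarticCoeff at h
  split_ifs at h with h'
  · exact h'.1
  · exact absurd rfl h

theorem sexticCoeff_ne_zero {m : Fin 6 → ℤ} (h : sexticCoeff m ≠ 0) :
    (m 3 ≠ m 0 ∧ m 4 ≠ m 0) ∧ m 0 + m 1 + m 2 - m 3 - m 4 - m 5 = 0 := by
  unfold sexticCoeff at h
  split_ifs at h with h'
  · exact ⟨⟨h'.1.1, h'.1.2.1⟩, h'.2.1⟩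
  · exact absurd rfl h

/-! ### Counting index tuples with prescribed denominators. -/

theorem ne_zero_of_mem_support {N : ℕ} {c : (Fin N → ℤ) → ℝ} {r : ℝ} (hr : 0 < r)
    {g : (Fin N → ℤ) → ℝ≥0∞} {m : Fin N → ℤ}
    (h : m ∈ Function.support fun m => ‖c m‖ₑ ^ r * g m) : c m ≠ 0 := by
  intro h0
  simp [h0, hr] at h

/-- Any one index, the two differences and the linear relation recover the whole tuple, so the sum
is dominated by a product of three independent sums. -/
theorem quartic_sumControlled {r : ℝ} (hr : 1 < r) (i : Fin 4) :
    SumControlled (fun m => ‖quarticCoeff m‖ₑ ^ r) {i} ((∑' k, decay r k) ^ 2) := by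
  intro g
  have hr0 : 0 < r := by linarith
  simp only [Finset.prod_singleton]
  refine (tsum_le_tsum_of_injOn (fun m : Fin 4 → ℤ => (m i, m 2 - m 0, m 2 - m 1))
    (G := fun x : ℤ × ℤ × ℤ => g i x.1 * (decay r x.2.1 * decay r x.2.2)) ?_ ?_).trans_eq ?_
  · intro m hm m' hm' h
    have h1 := quarticCoeff_ne_zero (ne_zero_of_mem_support hr0 hm)
    have h2 := quarticCoeff_ne_zero (ne_zero_of_mem_support hr0 hm')
    simp only [Prod.mk.injEq] at h
    obtain ⟨ha, hb, hc⟩ := h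
    funext k
    fin_cases i <;> fin_cases k <;> simp at ha ⊢ <;> omega
  · intro m _
    dsimp only
    rw [mul_comm]
    gcongr
    exact enorm_quarticCoeff_rpow_le hr0 m
  · simp only [ENNReal.tsum_prod', ENNReal.tsum_mul_left, ENNReal.tsum_mul_right]
    ring

/-- The linear relation gives one of the factors `m 0 - m 3`, `m 0 - m 4`. It is nonzero, by the
excluded coincidences of the sum, so the product gives the other one. -/
theorem eq_of_sextic {m m' : Fin 6 → ℤ} (h : (m 3 ≠ m 0 ∧ m 4 ≠ m 0) ∧
    m 0 + m 1 + m 2 - m 3 - m 4 - m 5 = 0) (h' : (m' 3 ≠ m' 0 ∧ m' 4 ≠ m' 0) ∧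
    m' 0 + m' 1 + m' 2 - m' 3 - m' 4 - m' 5 = 0)
    (h1 : m 1 = m' 1) (h2 : m 2 = m' 2) (h5 : m 5 = m' 5) (h34 : m 3 = m' 3 ∨ m 4 = m' 4)
    (hp : (m 0 - m 3) * (m 0 - m 4) = (m' 0 - m' 3) * (m' 0 - m' 4)) : m = m' := by
  obtain ⟨⟨ha, hb⟩, hl⟩ := h
  obtain ⟨⟨ha', hb'⟩, hl'⟩ := h'
  have : m 0 - m 3 = m' 0 - m' 3 ∧ m 0 - m 4 = m' 0 - m' 4 := by
    rcases h34 with h3 | h4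
    · have e : m 0 - m 4 = m' 0 - m' 4 := by omega
      rw [e] at hp
      exact ⟨mul_right_cancel₀ (by omega) hp, e⟩
    · have e : m 0 - m 3 = m' 0 - m' 3 := by omega
      rw [e] at hp
      exact ⟨e, mul_left_cancel₀ (by omega) hp⟩
  funext k
  fin_cases k <;> simp <;> omega

theorem eq_of_add_eq_of_mul_eq {A B A' B' : ℤ} (hs : A + B = A' + B') (hp : A * B = A' * B')
    (ho : A ≤ B ↔ A' ≤ B') : A = A' := by
  have h : (A - A') * (A - B') = 0 := by linear_combination A * hs - hp
  rcases mul_eq_zero.1 h with h | h <;> omega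

/-- The pair of positions `(i, k)` is among those for which the remaining variables are determined
by `m₆ - m₂`, `m₆ - m₃` and `q(m)`. -/
theorem sextic_sumControlled {r : ℝ} (hr : 1 < r) {i k : Fin 6} (hik : i ≠ k)
    (hd : ∀ m m' : Fin 6 → ℤ, m i = m' i → m k = m' k → m 5 - m 1 = m' 5 - m' 1 →
      m 5 - m 2 = m' 5 - m' 2 →
      (m 1 = m' 1 ∧ m 2 = m' 2 ∧ m 5 = m' 5) ∧ (m 0 = m' 0 ∨ m 3 = m' 3 ∨ m 4 = m' 4)) :
    SumControlled (fun m => ‖sexticCoeff m‖ₑ ^ r) {i, k} (2 * (∑' k, decay r k) ^ 3) := by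
  intro g
  have hr0 : 0 < r := by linarith
  simp only [Finset.prod_pair hik]
  -- If `m 0` is the known index, then only the sum and product of `m 0 - m 3` and `m 0 - m 4` are
  -- known, which leaves their order open. The Boolean records it and causes the factor `2` in the
  -- constant.
  refine (tsum_le_tsum_of_injOn (fun m : Fin 6 → ℤ => (m i, m k, m 5 - m 1, m 5 - m 2,
      (m 0 - m 3) * (m 0 - m 4) - (m 5 - m 1) * (m 5 - m 2), decide (m 0 - m 3 ≤ m 0 - m 4)))
    (G := fun x : ℤ × ℤ × ℤ × ℤ × ℤ × Bool => g i x.1 * (g k x.2.1 * (decay r x.2.2.1 *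
      (decay r x.2.2.2.1 * decay r x.2.2.2.2.1)))) ?_ ?_).trans_eq ?_
  · intro m hm m' hm' h
    have h1 := sexticCoeff_ne_zero (ne_zero_of_mem_support hr0 hm)
    have h2 := sexticCoeff_ne_zero (ne_zero_of_mem_support hr0 hm')
    simp only [Prod.mk.injEq, decide_eq_decide] at h
    obtain ⟨hi, hk, hD, hE, hP, ho⟩ := h
    obtain ⟨⟨e1, e2, e5⟩, e⟩ := hd m m' hi hk hD hE
    rw [hD, hE, sub_left_inj] at hP
    refine eq_of_sextic h1 h2 e1 e2 e5 ?_ hP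
    rcases e with e | e | e
    · left
      have := eq_of_add_eq_of_mul_eq (by omega) hP ho
      omega
    · exact .inl e
    · exact .inr e
  · intro m _
    dsimp only
    calc _ ≤ decay r (m 5 - m 1) * decay r (m 5 - m 2) *
          decay r ((m 0 - m 3) * (m 0 - m 4) - (m 5 - m 1) * (m 5 - m 2)) *
            (g i (m i) * g k (m k)) := by gcongr; exact enorm_sexticCoeff_rpow_le hr0 m
      _ = _ := by ring
  · simp only [ENNReal.tsum_prod', ENNReal.tsum_mul_left, ENNReal.tsum_mul_right, tsum_fintype,
      Finset.sum_const, Finset.card_univ, Fintype.card_bool, nsmul_eq_mul]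
    ring

/-- For every exponent `r > 1` and every position `j` the weight `|c|^r` is controlled by a set of
`p + 1` variables that contains `j`, and by one that does not. -/
def Dispersive {N : ℕ} (c : (Fin N → ℤ) → ℝ) (p : ℕ) : Prop :=
  ∀ r : ℝ, 1 < r → ∃ K : ℝ≥0∞, K ≠ ∞ ∧ ∀ j : Fin N,
    (∃ Z, j ∈ Z ∧ Z.card = p + 1 ∧ SumControlled (fun m => ‖c m‖ₑ ^ r) Z K) ∧
    (∃ Z, j ∉ Z ∧ Z.card = p + 1 ∧ SumControlled (fun m => ‖c m‖ₑ ^ r) Z K)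

theorem dispersive_quarticCoeff : Dispersive quarticCoeff 0 := by
  refine fun r hr => ⟨_, ENNReal.pow_ne_top (n := 2) (tsum_decay_lt_top hr).ne, fun j =>
    ⟨⟨{j}, by simp, by simp, quartic_sumControlled hr j⟩,
      ⟨{j + 1}, by simp, by simp, quartic_sumControlled hr _⟩⟩⟩

/-- A pair works if one member is in `{1, 2, 5}`, which the two differences tie together, and the
other is in `{0, 3, 4}`. The five pairs below suffice to contain, and to avoid, any given position.
-/
theorem dispersive_sexticCoeff : Dispersive sexticCoeff 1 := by
  intro r hr
  have h53 := sextic_sumControlled hr (i := 5) (k := 3) (by decide) (by intros; omega)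
  have h54 := sextic_sumControlled hr (i := 5) (k := 4) (by decide) (by intros; omega)
  have h13 := sextic_sumControlled hr (i := 1) (k := 3) (by decide) (by intros; omega)
  have h23 := sextic_sumControlled hr (i := 2) (k := 3) (by decide) (by intros; omega)
  have h05 := sextic_sumControlled hr (i := 0) (k := 5) (by decide) (by intros; omega)
  refine ⟨_, ENNReal.mul_ne_top (ENNReal.ofNat_ne_top (n := 2))
    (ENNReal.pow_ne_top (n := 3) (tsum_decay_lt_top hr).ne), fun j => ?_⟩
  fin_cases j
  · exact ⟨⟨_, by decide, by decide, h05⟩, ⟨_, by decide, by decide, h53⟩⟩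
  · exact ⟨⟨_, by decide, by decide, h13⟩, ⟨_, by decide, by decide, h53⟩⟩
  · exact ⟨⟨_, by decide, by decide, h23⟩, ⟨_, by decide, by decide, h53⟩⟩
  · exact ⟨⟨_, by decide, by decide, h53⟩, ⟨_, by decide, by decide, h54⟩⟩
  · exact ⟨⟨_, by decide, by decide, h54⟩, ⟨_, by decide, by decide, h53⟩⟩
  · exact ⟨⟨_, by decide, by decide, h53⟩, ⟨_, by decide, by decide, h13⟩⟩

/-! ### The phase space and conjugation flags. -/

/-- The phase space `ℓ¹(ℤ)`. -/
abbrev L1 : Type := lp (fun _ : ℤ => ℂ) 1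

theorem L1.enorm_eq (f : L1) : ‖f‖ₑ = ∑' n, ‖f n‖ₑ := by
  have h : HasSum (fun n => ‖f n‖) ‖f‖ := by
    simpa using lp.hasSum_norm (p := 1) (by simp) f
  rw [← ofReal_norm, ← h.tsum_eq,
    ENNReal.ofReal_tsum_of_nonneg (fun _ => norm_nonneg _) h.summable]
  simp

theorem memℓp_one_of_tsum_enorm {f : ℤ → ℂ} (h : ∑' n, ‖f n‖ₑ ≠ ∞) : Memℓp f 1 := by
  apply memℓp_gen
  have h1 : Summable fun n => ‖f n‖₊ := ENNReal.tsum_coe_ne_top_iff_summable.1 h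
  simpa using! NNReal.summable_coe.2 h1

theorem summable_of_tsum_enorm {α : Type*} {f : α → ℂ} (h : ∑' n, ‖f n‖ₑ ≠ ∞) : Summable f :=
  .of_nnnorm (ENNReal.tsum_coe_ne_top_iff_summable.1 h)

theorem enorm_tsum_le {α : Type*} (f : α → ℂ) : ‖∑' a, f a‖ₑ ≤ ∑' a, ‖f a‖ₑ := by
  by_cases h : ∑' a, ‖f a‖ₑ = ∞
  · simp [h]
  · have h1 : Summable fun n => ‖f n‖₊ := ENNReal.tsum_coe_ne_top_iff_summable.1 h
    rw [enorm_eq_nnnorm]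
    simp_rw [enorm_eq_nnnorm]
    rw [← ENNReal.coe_tsum h1]
    exact_mod_cast nnnorm_tsum_le h1

theorem L1.norm_le_of_tsum_enorm_le {f : L1} {R : ℝ} (hR : 0 ≤ R)
    (h : ∑' n, ‖f n‖ₑ ≤ ENNReal.ofReal R) : ‖f‖ ≤ R := by
  rwa [← L1.enorm_eq, ← ofReal_norm, ENNReal.ofReal_le_ofReal_iff hR] at h

/-- Complex conjugation if the flag is set. -/
def cj (b : Bool) : ℂ →ₗ[ℝ] ℂ := if b then Complex.conjAe.toLinearMap else LinearMap.id

@[simp] theorem cj_true (z : ℂ) : cj true z = conj z := rfl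

@[simp] theorem cj_false (z : ℂ) : cj false z = z := rfl

@[simp] theorem enorm_cj (b : Bool) (z : ℂ) : ‖cj b z‖ₑ = ‖z‖ₑ := by
  cases b
  · rfl
  · rw [cj_true, ← ofReal_norm, RCLike.norm_conj, ofReal_norm]

theorem enorm_prod_cj {n : ℕ} (b : Fin n → Bool) (z : Fin n → ℂ) :
    ‖∏ i, cj (b i) (z i)‖ₑ = ∏ i, ‖z i‖ₑ := by
  rw [← ofReal_norm, norm_prod, ENNReal.ofReal_prod_of_nonneg fun _ _ => norm_nonneg _]
  simp only [ofReal_norm, enorm_cj]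

theorem conj_cj (b : Bool) (z : ℂ) : conj (cj b z) = cj (!b) z := by cases b <;> simp

/-! ### Multilinear maps on `ℓ¹` given by kernels -/

section Kernel

variable {n : ℕ} (k : ℤ → (Fin n → ℤ) → ℂ) (b : Fin n → Bool)

/-- Summing over the output first uses up the kernel and leaves the product of the `ℓ¹` norms. -/
theorem tsum_enorm_kernel_le (hk : ∀ y, ∑' x, ‖k x y‖ₑ ≤ 1) (f : Fin n → L1) :
    ∑' (x : ℤ) (y : Fin n → ℤ), ‖k x y * ∏ i, cj (b i) (f i (y i))‖ₑ ≤ ∏ i, ‖f i‖ₑ := by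
  rw [ENNReal.tsum_comm]
  simp_rw [L1.enorm_eq]
  rw [← tsum_pi_prod fun i x => ‖f i x‖ₑ]
  refine ENNReal.tsum_le_tsum fun y => ?_
  simp_rw [enorm_mul, enorm_prod_cj]
  rw [ENNReal.tsum_mul_right]
  exact mul_le_of_le_one_left' (hk y)

variable {k}

theorem prod_enorm_ne_top (f : Fin n → L1) : ∏ i, ‖f i‖ₑ ≠ ∞ :=
  (ENNReal.prod_lt_top fun _ _ => enorm_lt_top).ne

theorem tsum_enorm_tsum_kernel_le (hk : ∀ y, ∑' x, ‖k x y‖ₑ ≤ 1) (f : Fin n → L1) :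
    ∑' x, ‖∑' y : Fin n → ℤ, k x y * ∏ i, cj (b i) (f i (y i))‖ₑ ≤ ∏ i, ‖f i‖ₑ :=
  (ENNReal.tsum_le_tsum fun _ => enorm_tsum_le _).trans (tsum_enorm_kernel_le k b hk f)

theorem summable_kernel (hk : ∀ y, ∑' x, ‖k x y‖ₑ ≤ 1) (f : Fin n → L1) (x : ℤ) :
    Summable fun y : Fin n → ℤ => k x y * ∏ i, cj (b i) (f i (y i)) :=
  summable_of_tsum_enorm (ne_top_of_le_ne_top (prod_enorm_ne_top f)
    ((ENNReal.le_tsum x).trans (tsum_enorm_kernel_le k b hk f)))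

/-- The multilinear map with one term of the kernel. -/
def kernelTerm (b : Fin n → Bool) (y : Fin n → ℤ) : MultilinearMap ℝ (fun _ : Fin n => L1) ℂ :=
  (MultilinearMap.mkPiAlgebra ℝ (Fin n) ℂ).compLinearMap
    fun i => (cj (b i)).comp (lp.evalₗ (fun _ => ℂ) 1 (y i))

theorem kernelTerm_apply (b : Fin n → Bool) (y : Fin n → ℤ) (f : Fin n → L1) :
    kernelTerm b y f = ∏ i, cj (b i) (f i (y i)) := by
  simp [kernelTerm]

/-- The multilinear map on `ℓ¹` with kernel `k`, conjugate-linear in the flagged slots. -/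
def kernelMap (k : ℤ → (Fin n → ℤ) → ℂ) (b : Fin n → Bool) (hk : ∀ y, ∑' x, ‖k x y‖ₑ ≤ 1) :
    ContinuousMultilinearMap ℝ (fun _ : Fin n => L1) L1 :=
  MultilinearMap.mkContinuous
    { toFun := fun f => ⟨fun x => ∑' y : Fin n → ℤ, k x y * ∏ i, cj (b i) (f i (y i)),
        memℓp_one_of_tsum_enorm
          (ne_top_of_le_ne_top (prod_enorm_ne_top f) (tsum_enorm_tsum_kernel_le b hk f))⟩
      map_update_add' := fun f i u v => lp.ext (funext fun x => by
        refine Eq.trans ?_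
          (Summable.tsum_add (summable_kernel b hk _ x) (summable_kernel b hk _ x))
        simp_rw [← kernelTerm_apply, MultilinearMap.map_update_add, mul_add])
      map_update_smul' := fun f i c u => lp.ext (funext fun x => by
        refine Eq.trans ?_ ((summable_kernel b hk _ x).tsum_const_smul c)
        simp_rw [← kernelTerm_apply, MultilinearMap.map_update_smul, mul_smul_comm]) }
    1 fun f => by
      refine L1.norm_le_of_tsum_enorm_le (by positivity) ?_
      refine (tsum_enorm_tsum_kernel_le b hk f).trans_eq ?_
      rw [one_mul, ENNReal.ofReal_prod_of_nonneg fun _ _ => norm_nonneg _]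
      simp

theorem kernelMap_apply (hk : ∀ y, ∑' x, ‖k x y‖ₑ ≤ 1) (f : Fin n → L1) (x : ℤ) :
    kernelMap k b hk f x = ∑' y : Fin n → ℤ, k x y * ∏ i, cj (b i) (f i (y i)) := rfl

end Kernel

/-! ### Hamiltonians as multilinear forms and their vector fields. -/

variable {n : ℕ}

/-- The sign of a slot: `-1` for the conjugated ones. -/
def sgn (b : Bool) : ℤ := if b then -1 else 1

/-- Real coefficients, bounded by `1` and supported where the signed sum of the indices vanishes. -/
structure IsCoeff (σ : Fin (n + 1) → Bool) (c : (Fin (n + 1) → ℤ) → ℝ) : Prop where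
  abs_le_one : ∀ m, |c m| ≤ 1
  sum_eq_zero : ∀ m, c m ≠ 0 → ∑ i, sgn (σ i) * m i = 0
  balanced : ∑ i, sgn (σ i) = 0

/-- The homogeneous polynomial with coefficients `c`, in `v` and (for the flagged slots) `v̄`. -/
def ham (σ : Fin (n + 1) → Bool) (c : (Fin (n + 1) → ℤ) → ℝ) (v : ℤ → ℂ) : ℂ :=
  ∑' m, (c m : ℂ) * ∏ i, cj (σ i) (v (m i))

/-- The component of the Hamiltonian vector field of `ham - conj ham` in which slot `j` is the
output. -/
def fieldTerm (σ : Fin (n + 1) → Bool) (c : (Fin (n + 1) → ℤ) → ℝ) (j : Fin (n + 1)) (v : ℤ → ℂ)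
    (x : ℤ) : ℂ :=
  ∑' y : Fin n → ℤ, (c (j.insertNth x y) : ℂ) * ∏ i, cj (σ (j.succAbove i) == σ j) (v (y i))

/-- The vector field of `ham - conj ham`. -/
def field (σ : Fin (n + 1) → Bool) (c : (Fin (n + 1) → ℤ) → ℝ) (v : ℤ → ℂ) (x : ℤ) : ℂ :=
  -∑ j, (sgn (σ j) : ℂ) * fieldTerm σ c j v x

/-- The kernel with the output only at `0`. -/
def formKernel (c : (Fin n → ℤ) → ℝ) (x : ℤ) (m : Fin n → ℤ) : ℂ :=
  (Pi.single 0 (c m : ℂ) : ℤ → ℂ) x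

theorem tsum_enorm_formKernel_le {c : (Fin n → ℤ) → ℝ} (hc : ∀ m, |c m| ≤ 1) (m : Fin n → ℤ) :
    ∑' x, ‖formKernel c x m‖ₑ ≤ 1 := by
  rw [tsum_eq_single 0 fun x hx => by simp [formKernel, hx], formKernel, Pi.single_eq_same,
    ← ofReal_norm, Complex.norm_real]
  exact ENNReal.ofReal_le_one.2 (hc m)

/-- The real-multilinear form with coefficients `c`. -/
def form (c : (Fin n → ℤ) → ℝ) (b : Fin n → Bool) (hc : ∀ m, |c m| ≤ 1) :
    ContinuousMultilinearMap ℝ (fun _ : Fin n => L1) ℂ :=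
  (lp.evalCLM ℝ (fun _ : ℤ => ℂ) 1 0).compContinuousMultilinearMap
    (kernelMap (formKernel c) b (tsum_enorm_formKernel_le hc))

theorem form_apply {c : (Fin n → ℤ) → ℝ} (b : Fin n → Bool) (hc : ∀ m, |c m| ≤ 1)
    (f : Fin n → L1) : form c b hc f = ∑' m, (c m : ℂ) * ∏ i, cj (b i) (f i (m i)) := by
  have h := kernelMap_apply b (tsum_enorm_formKernel_le hc) f 0
  refine Eq.trans (b := kernelMap (formKernel c) b (tsum_enorm_formKernel_le hc) f 0) rfl ?_
  rw [h]
  simp [formKernel]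

theorem summable_form {c : (Fin n → ℤ) → ℝ} (b : Fin n → Bool) (hc : ∀ m, |c m| ≤ 1)
    (f : Fin n → L1) : Summable fun m : Fin n → ℤ => (c m : ℂ) * ∏ i, cj (b i) (f i (m i)) := by
  simpa [formKernel] using summable_kernel b (tsum_enorm_formKernel_le hc) f 0

theorem form_update_single {c : (Fin (n + 1) → ℤ) → ℝ} (b : Fin (n + 1) → Bool)
    (hc : ∀ m, |c m| ≤ 1) (w : L1) (j : Fin (n + 1)) (x : ℤ) (z : ℂ) :
    form c b hc (Function.update (fun _ => w) j (lp.single 1 x z))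
      = cj (b j) z * ∑' y : Fin n → ℤ, (c (j.insertNth x y) : ℂ) *
          ∏ i, cj (b (j.succAbove i)) (w (y i)) := by
  rw [form_apply, ← tsum_mul_left]
  have hinj : Function.Injective fun y : Fin n → ℤ => (j.insertNth x y : Fin (n + 1) → ℤ) :=
    Fin.insertNth_right_injective (α := fun _ => ℤ) x
  rw [← hinj.tsum_eq]
  · refine tsum_congr fun y => ?_
    rw [Fin.prod_univ_succAbove _ j]
    simp only [Fin.insertNth_apply_same, Fin.insertNth_apply_succAbove, Function.update_self,
      Function.update_of_ne (Fin.succAbove_ne j _), lp.single_apply_self]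
    ring
  · intro m hm
    have hx : m j = x := by
      by_contra hne
      apply hm
      dsimp only
      rw [Fin.prod_univ_succAbove _ j, Function.update_self, lp.single_apply_ne _ _ _ hne]
      simp
    exact ⟨j.removeNth m, by simp [← hx]⟩

theorem coe_add_smul_single (w : L1) (x : ℤ) (z : ℂ) (t : ℝ) :
    ⇑(w + t • (lp.single 1 x z : L1)) = ⇑w + Pi.single x ((t : ℂ) * z) := by
  rw [lp.coeFn_add, lp.coeFn_smul, lp.coeFn_single, ← Pi.single_smul, Complex.real_smul]

/-- The Hamiltonian is the diagonal of a bounded real-multilinear form, and changing one coordinate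
moves along a line in `ℓ¹`; the product rule gives one term per slot. -/
theorem hasDerivAt_ham {σ : Fin (n + 1) → Bool} {c : (Fin (n + 1) → ℤ) → ℝ}
    (hc : ∀ m, |c m| ≤ 1) (w : L1) (x : ℤ) (z : ℂ) :
    HasDerivAt (fun t : ℝ => ham σ c (⇑w + Pi.single x ((t : ℂ) * z)))
      (∑ j, cj (σ j) z * ∑' y : Fin n → ℤ, (c (j.insertNth x y) : ℂ) *
          ∏ i, cj (σ (j.succAbove i)) (w (y i))) 0 := by
  have hd : HasDerivAt (fun t : ℝ => fun _ : Fin (n + 1) => w + t • (lp.single 1 x z : L1))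
      (fun _ : Fin (n + 1) => (lp.single 1 x z : L1)) 0 := by
    refine hasDerivAt_pi.2 fun _ => ?_
    have := ((hasDerivAt_id (0 : ℝ)).smul_const (lp.single 1 x z : L1)).const_add w
    rwa [one_smul] at this
  have hf := (ContinuousMultilinearMap.hasFDerivAt (form c σ hc)
    (fun _ => w + (0 : ℝ) • (lp.single 1 x z : L1))).comp_hasDerivAt (0 : ℝ) hd
  have e : (fun t : ℝ => ham σ c (⇑w + Pi.single x ((t : ℂ) * z)))
      = ⇑(form c σ hc) ∘ fun t : ℝ => fun _ => w + t • (lp.single 1 x z : L1) := by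
    funext t
    rw [Function.comp_apply, form_apply, ham, coe_add_smul_single]
  rw [e]
  convert! hf using 1
  rw [ContinuousMultilinearMap.linearDeriv_apply]
  refine Finset.sum_congr rfl fun j _ => ?_
  simp only [zero_smul, add_zero]
  rw [← form_update_single σ hc w j x z]

theorem conj_tsum {α : Type*} (f : α → ℂ) : conj (∑' a, f a) = ∑' a, conj (f a) :=
  Complex.conj_tsum f

theorem conj_fieldTerm_aux (c : (Fin (n + 1) → ℤ) → ℝ) (b : Fin n → Bool) (j : Fin (n + 1))
    (v : ℤ → ℂ) (x : ℤ) :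
    conj (∑' y : Fin n → ℤ, (c (j.insertNth x y) : ℂ) * ∏ i, cj (b i) (v (y i)))
      = ∑' y : Fin n → ℤ, (c (j.insertNth x y) : ℂ) * ∏ i, cj (!b i) (v (y i)) := by
  rw [conj_tsum]
  simp only [map_mul, Complex.conj_ofReal, map_prod, conj_cj]

/-- The Wirtinger derivative sees only conjugated factors: a flagged slot contributes through `ham`,
an unflagged one through `-conj ham`, where it becomes conjugated and all other flags flip. Hence
the sign `-sgn (σ j)` and the flags `σ (j.succAbove i) == σ j`. -/
theorem dbar_ham {σ : Fin (n + 1) → Bool} {c : (Fin (n + 1) → ℤ) → ℝ} (hc : ∀ m, |c m| ≤ 1)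
    (w : L1) (x : ℤ) : dbar (fun v => ham σ c v - conj (ham σ c v)) w x = field σ c w x := by
  have h1 := hasDerivAt_ham (σ := σ) hc w x 1
  have h2 := hasDerivAt_ham (σ := σ) hc w x Complex.I
  simp only [mul_one] at h1
  have h1' := (h1.sub ((Complex.conjCLE : ℂ →L[ℝ] ℂ).hasFDerivAt.comp_hasDerivAt 0 h1)).deriv
  have h2' := (h2.sub ((Complex.conjCLE : ℂ →L[ℝ] ℂ).hasFDerivAt.comp_hasDerivAt 0 h2)).deriv
  unfold dbar field
  erw [h1', h2']
  simp only [ContinuousLinearEquiv.coe_coe, Complex.conjCLE_apply, map_sum, map_mul]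
  rw [← Finset.sum_sub_distrib, ← Finset.sum_sub_distrib, Finset.mul_sum,
    ← Finset.sum_add_distrib, Finset.sum_div, ← Finset.sum_neg_distrib]
  refine Finset.sum_congr rfl fun j _ => ?_
  unfold fieldTerm
  cases hj : σ j
  · have e := conj_fieldTerm_aux c (fun i => σ (j.succAbove i)) j w x
    have e' : ∀ i, (σ (j.succAbove i) == false) = !σ (j.succAbove i) := fun i => by
      cases σ (j.succAbove i) <;> rfl
    simp only [e', ← e, sgn, cj_false, map_one, Complex.conj_I]
    push_cast
    linear_combination (1 / 2) * ((∑' y : Fin n → ℤ, (c (j.insertNth x y) : ℂ) *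
      ∏ i, cj (σ (j.succAbove i)) (w (y i))) + conj (∑' y : Fin n → ℤ,
      (c (j.insertNth x y) : ℂ) * ∏ i, cj (σ (j.succAbove i)) (w (y i)))) * Complex.I_mul_I
  · have e' : ∀ i, (σ (j.succAbove i) == true) = σ (j.succAbove i) := fun i => by
      cases σ (j.succAbove i) <;> rfl
    simp only [e', sgn, cj_true, map_one, Complex.conj_I, map_neg]
    push_cast
    linear_combination (-1 / 2) * ((∑' y : Fin n → ℤ, (c (j.insertNth x y) : ℂ) *
      ∏ i, cj (σ (j.succAbove i)) (w (y i))) + conj (∑' y : Fin n → ℤ,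
      (c (j.insertNth x y) : ℂ) * ∏ i, cj (σ (j.succAbove i)) (w (y i)))) * Complex.I_mul_I

variable {n : ℕ}

/-! ### The vector field on `ℓ¹`, conjugated by an exponential weight -/

section WeightedField

variable {σ : Fin (n + 1) → Bool} {c : (Fin (n + 1) → ℤ) → ℝ}

theorem IsCoeff.sgn_mul_eq (h : IsCoeff σ c) {j : Fin (n + 1)} {x : ℤ} {y : Fin n → ℤ}
    (hne : c (j.insertNth x y) ≠ 0) :
    sgn (σ j) * x = -∑ i, sgn (σ (j.succAbove i)) * y i := by
  have := h.sum_eq_zero _ hne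
  rw [Fin.sum_univ_succAbove _ j] at this
  simp only [Fin.insertNth_apply_same, Fin.insertNth_apply_succAbove] at this
  linarith

theorem abs_sgn_mul (b : Bool) (x : ℤ) : |sgn b * x| = |x| := by cases b <;> simp [sgn]

theorem IsCoeff.abs_le_sum (h : IsCoeff σ c) {j : Fin (n + 1)} {x : ℤ} {y : Fin n → ℤ}
    (hne : c (j.insertNth x y) ≠ 0) : |x| ≤ ∑ i, |y i| := by
  rw [← abs_sgn_mul (σ j), h.sgn_mul_eq hne, abs_neg]
  exact (Finset.abs_sum_le_sum_abs _ _).trans_eq (by simp only [abs_sgn_mul])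

theorem IsCoeff.eq_of_ne_zero (h : IsCoeff σ c) {j : Fin (n + 1)} {x x' : ℤ} {y : Fin n → ℤ}
    (hne : c (j.insertNth x y) ≠ 0) (hne' : c (j.insertNth x' y) ≠ 0) : x = x' := by
  have := (h.sgn_mul_eq hne).trans (h.sgn_mul_eq hne').symm
  refine mul_left_cancel₀ ?_ this
  cases σ j <;> simp [sgn]

/-- The kernel of the vector field with output in slot `j`, conjugated by `e^{δ|n|}`. -/
def weightedKernel (c : (Fin (n + 1) → ℤ) → ℝ) (δ : ℝ) (j : Fin (n + 1)) (x : ℤ)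
    (y : Fin n → ℤ) : ℂ :=
  ((Real.exp (δ * |(x : ℝ)| - ∑ i, δ * |(y i : ℝ)|) * c (j.insertNth x y) : ℝ) : ℂ)

/-- The exponent is nonpositive on the support of `c` by the triangle inequality. All uniformity in
`δ` comes from here. -/
theorem IsCoeff.enorm_weightedKernel_le (h : IsCoeff σ c) {δ : ℝ} (hδ : 0 ≤ δ) (j : Fin (n + 1))
    (x : ℤ) (y : Fin n → ℤ) :
    ‖weightedKernel c δ j x y‖ₑ ≤ ‖c (j.insertNth x y)‖ₑ := by
  rw [weightedKernel, ← ofReal_norm, Complex.norm_real, ofReal_norm, enorm_mul]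
  by_cases h0 : c (j.insertNth x y) = 0
  · simp [h0]
  · refine mul_le_of_le_one_left' ?_
    rw [Real.enorm_eq_ofReal (Real.exp_nonneg _)]
    refine ENNReal.ofReal_le_one.2 (Real.exp_le_one_iff.2 ?_)
    rw [← Finset.mul_sum, ← mul_sub]
    refine mul_nonpos_of_nonneg_of_nonpos hδ ?_
    rw [sub_nonpos]
    exact_mod_cast h.abs_le_sum h0

theorem IsCoeff.enorm_le_one (h : IsCoeff σ c) (m : Fin (n + 1) → ℤ) : ‖c m‖ₑ ≤ 1 := by
  rw [← ofReal_norm]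
  exact ENNReal.ofReal_le_one.2 (h.abs_le_one m)

theorem IsCoeff.tsum_enorm_weightedKernel_le (h : IsCoeff σ c) {δ : ℝ} (hδ : 0 ≤ δ)
    (j : Fin (n + 1)) (y : Fin n → ℤ) : ∑' x, ‖weightedKernel c δ j x y‖ₑ ≤ 1 := by
  refine (ENNReal.tsum_le_tsum fun x => h.enorm_weightedKernel_le hδ j x y).trans ?_
  by_cases hx : ∃ x, c (j.insertNth x y) ≠ 0
  · obtain ⟨x, hx⟩ := hx
    rw [tsum_eq_single x]
    · exact h.enorm_le_one _
    · intro x' hx'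
      rw [enorm_eq_zero]
      by_contra hne
      exact hx' (h.eq_of_ne_zero hne hx)
  · push Not at hx
    simp [hx]

/-- The vector field of `ham - conj ham`, conjugated by the weight `e^{δ|n|}`. -/
def IsCoeff.weightedField (h : IsCoeff σ c) {δ : ℝ} (hδ : 0 ≤ δ) (w : L1) : L1 :=
  -∑ j, (sgn (σ j) : ℝ) • kernelMap (weightedKernel c δ j)
    (fun i => σ (j.succAbove i) == σ j) (h.tsum_enorm_weightedKernel_le hδ j) fun _ => w

theorem IsCoeff.weightedField_apply (h : IsCoeff σ c) {δ : ℝ} (hδ : 0 ≤ δ) (w : L1) (x : ℤ) :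
    h.weightedField hδ w x = -∑ j, (sgn (σ j) : ℂ) * ∑' y : Fin n → ℤ, weightedKernel c δ j x y *
      ∏ i, cj (σ (j.succAbove i) == σ j) (w (y i)) := by
  rw [IsCoeff.weightedField, lp.coeFn_neg, Pi.neg_apply, lp.coeFn_sum, Finset.sum_apply]
  rfl

theorem cj_ofReal_mul (b : Bool) (r : ℝ) (z : ℂ) : cj b (r * z) = r * cj b z := by
  cases b <;> simp

theorem IsCoeff.field_eq (h : IsCoeff σ c) {δ : ℝ} (hδ : 0 ≤ δ) (w : L1) (x : ℤ) :
    field σ c (fun k => (Real.exp (-(δ * |(k : ℝ)|)) : ℂ) * w k) x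
      = (Real.exp (-(δ * |(x : ℝ)|)) : ℂ) * h.weightedField hδ w x := by
  rw [h.weightedField_apply, field, mul_neg, Finset.mul_sum]
  congr 1
  refine Finset.sum_congr rfl fun j _ => ?_
  rw [mul_left_comm, fieldTerm]
  congr 1
  refine Eq.trans ?_ tsum_mul_left
  refine tsum_congr fun y => ?_
  simp only [cj_ofReal_mul, Finset.prod_mul_distrib, weightedKernel]
  rw [sub_eq_add_neg, Real.exp_add, ← Finset.sum_neg_distrib, Real.exp_sum, Real.exp_neg]
  push_cast
  have := Complex.exp_ne_zero (δ * (|(x : ℝ)| : ℝ))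
  field_simp

theorem IsCoeff.weightedField_zero_apply (h : IsCoeff σ c) (w : L1) (x : ℤ) :
    h.weightedField le_rfl w x = field σ c w x := by
  simpa using (h.field_eq le_rfl w x).symm

end WeightedField

/-! ### Maps that are Lipschitz on balls -/

/-- The map is Lipschitz on every ball. -/
def LipOnBalls {E F : Type*} [NormedAddCommGroup E] [NormedAddCommGroup F] (f : E → F) : Prop :=
  ∀ R : ℝ, ∃ K : ℝ, ∀ x y, ‖x‖ ≤ R → ‖y‖ ≤ R → ‖f x - f y‖ ≤ K * ‖x - y‖

section LipOnBalls

variable {E F G H : Type*} [NormedAddCommGroup E] [NormedAddCommGroup F] [NormedAddCommGroup G]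
  [NormedAddCommGroup H]

theorem ContinuousMultilinearMap.lipOnBalls [NormedSpace ℝ E] [NormedSpace ℝ F]
    (A : ContinuousMultilinearMap ℝ (fun _ : Fin n => E) F) : LipOnBalls fun x => A fun _ => x := by
  intro R
  refine ⟨‖A‖ * Fintype.card (Fin n) * |R| ^ (Fintype.card (Fin n) - 1), fun x y hx hy => ?_⟩
  refine (A.norm_image_sub_le _ _).trans ?_
  have hb : ∀ z : E, ‖z‖ ≤ R → ‖(fun _ : Fin n => z)‖ ≤ |R| := fun z hz =>
    (pi_norm_const_le z).trans (hz.trans (le_abs_self R))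
  gcongr
  · exact max_le (hb x hx) (hb y hy)
  · exact pi_norm_const_le (x - y)

theorem LipOnBalls.neg {f : E → F} (hf : LipOnBalls f) : LipOnBalls fun x => -f x := by
  intro R
  obtain ⟨K, hK⟩ := hf R
  refine ⟨K, fun x y hx hy => ?_⟩
  rw [← neg_sub_neg, neg_neg, neg_neg, norm_sub_rev]
  exact hK x y hx hy

theorem LipOnBalls.const_smul [NormedSpace ℝ F] {f : E → F} (hf : LipOnBalls f) (a : ℝ) :
    LipOnBalls fun x => a • f x := by
  intro R
  obtain ⟨K, hK⟩ := hf R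
  refine ⟨|a| * K, fun x y hx hy => ?_⟩
  rw [← smul_sub, norm_smul, Real.norm_eq_abs, mul_assoc]
  exact mul_le_mul_of_nonneg_left (hK x y hx hy) (abs_nonneg a)

theorem LipOnBalls.sum {ι : Type*} (s : Finset ι) {f : ι → E → F} (hf : ∀ i, LipOnBalls (f i)) :
    LipOnBalls fun x => ∑ i ∈ s, f i x := by
  intro R
  choose K hK using fun i => hf i R
  refine ⟨∑ i ∈ s, K i, fun x y hx hy => ?_⟩
  rw [← Finset.sum_sub_distrib, Finset.sum_mul]
  exact norm_sum_le_of_le s fun i _ => hK i x y hx hy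

theorem LipOnBalls.comp_clm [NormedSpace ℝ E] [NormedSpace ℝ F] [NormedSpace ℝ G]
    [NormedSpace ℝ H] {f : F → G} (hf : LipOnBalls f) (T : G →L[ℝ] H) (S : E →L[ℝ] F) :
    LipOnBalls fun x => T (f (S x)) := by
  intro R
  obtain ⟨K, hK⟩ := hf (‖S‖ * R)
  refine ⟨‖T‖ * |K| * ‖S‖, fun x y hx hy => ?_⟩
  rw [← map_sub]
  have hS : ∀ z, ‖z‖ ≤ R → ‖S z‖ ≤ ‖S‖ * R := fun z hz => S.le_opNorm_of_le hz
  calc ‖T (f (S x) - f (S y))‖ ≤ ‖T‖ * (|K| * (‖S‖ * ‖x - y‖)) := by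
        refine T.le_opNorm_of_le ((hK _ _ (hS x hx) (hS y hy)).trans ?_)
        rw [← map_sub]
        gcongr
        · exact le_abs_self K
        · exact S.le_opNorm _
    _ = _ := by ring

theorem LipOnBalls.lipschitzOnWith {f : E → F} (hf : LipOnBalls f) (x₀ : E) (R : ℝ) :
    ∃ K, LipschitzOnWith K f (Metric.closedBall x₀ R) := by
  obtain ⟨K, hK⟩ := hf (‖x₀‖ + R)
  have hb : ∀ x ∈ Metric.closedBall x₀ R, ‖x‖ ≤ ‖x₀‖ + R := fun x hx => by
    rw [mem_closedBall_iff_norm] at hx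
    linarith [norm_le_norm_add_norm_sub' x x₀]
  refine ⟨K.toNNReal, LipschitzOnWith.of_dist_le_mul fun x hx y hy => ?_⟩
  rw [dist_eq_norm, dist_eq_norm]
  refine (hK x y (hb x hx) (hb y hy)).trans ?_
  gcongr
  exact Real.le_coe_toNNReal K

theorem LipOnBalls.continuous {f : E → F} (hf : LipOnBalls f) : Continuous f := by
  refine continuous_iff_continuousAt.2 fun x => ?_
  obtain ⟨K, hK⟩ := hf.lipschitzOnWith x 1
  exact hK.continuousOn.continuousAt (Metric.closedBall_mem_nhds x one_pos)

end LipOnBalls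

theorem IsCoeff.lipOnBalls_weightedField {σ : Fin (n + 1) → Bool} {c : (Fin (n + 1) → ℤ) → ℝ}
    (h : IsCoeff σ c) {δ : ℝ} (hδ : 0 ≤ δ) : LipOnBalls (h.weightedField hδ) :=
  .neg (.sum _ fun _ => .const_smul (ContinuousMultilinearMap.lipOnBalls _) _)

/-! ### Integral curves on the unit interval -/

/-- `w` is an integral curve of `V` on `[0, 1]`. -/
def IsCurve {E : Type*} [NormedAddCommGroup E] [NormedSpace ℝ E] (V : E → E) (w : ℝ → E) : Prop :=
  ∀ s ∈ Set.Icc (0 : ℝ) 1, HasDerivWithinAt w (V (w s)) (Set.Icc 0 1) s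

theorem IsCurve.continuousOn {E : Type*} [NormedAddCommGroup E] [NormedSpace ℝ E] {V : E → E}
    {w : ℝ → E} (h : IsCurve V w) : ContinuousOn w (Set.Icc 0 1) := fun s hs =>
  (h s hs).continuousWithinAt

/-- Two curves over a compact interval lie in a common ball, where `V` is Lipschitz, so Grönwall
applies. Agreement at time `0` will give single-valuedness of the flow, agreement at time `1`
injectivity. -/
theorem IsCurve.eqOn {E : Type*} [NormedAddCommGroup E] [NormedSpace ℝ E] {V : E → E}
    (hV : LipOnBalls V) {w w' : ℝ → E} (h : IsCurve V w) (h' : IsCurve V w')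
    (he : w 0 = w' 0 ∨ w 1 = w' 1) : Set.EqOn w w' (Set.Icc 0 1) := by
  obtain ⟨R, hR⟩ := isCompact_Icc.exists_bound_of_continuousOn h.continuousOn
  obtain ⟨R', hR'⟩ := isCompact_Icc.exists_bound_of_continuousOn h'.continuousOn
  obtain ⟨K, hK⟩ := hV.lipschitzOnWith 0 (max R R')
  have hm : ∀ t ∈ Set.Icc (0 : ℝ) 1, w t ∈ Metric.closedBall 0 (max R R') := fun t ht =>
    mem_closedBall_zero_iff.2 ((hR t ht).trans (le_max_left _ _))
  have hm' : ∀ t ∈ Set.Icc (0 : ℝ) 1, w' t ∈ Metric.closedBall 0 (max R R') := fun t ht =>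
    mem_closedBall_zero_iff.2 ((hR' t ht).trans (le_max_right _ _))
  rcases he with he | he
  · have hd : ∀ {u : ℝ → E}, IsCurve V u → ∀ t ∈ Set.Ico (0 : ℝ) 1,
        HasDerivWithinAt u (V (u t)) (Set.Ici t) t := fun hu t ht =>
      (hu t (Set.Ico_subset_Icc_self ht)).mono_of_mem_nhdsWithin (Icc_mem_nhdsGE_of_mem ht)
    exact ODE_solution_unique_of_mem_Icc_right (v := fun _ => V)
      (s := fun _ => Metric.closedBall 0 (max R R')) (fun _ _ => hK) h.continuousOn (hd h)
      (fun t ht => hm t (Set.Ico_subset_Icc_self ht)) h'.continuousOn (hd h')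
      (fun t ht => hm' t (Set.Ico_subset_Icc_self ht)) he
  · have hd : ∀ {u : ℝ → E}, IsCurve V u → ∀ t ∈ Set.Ioc (0 : ℝ) 1,
        HasDerivWithinAt u (V (u t)) (Set.Iic t) t := fun hu t ht =>
      (hu t (Set.Ioc_subset_Icc_self ht)).mono_of_mem_nhdsWithin (Icc_mem_nhdsLE_of_mem ht)
    exact ODE_solution_unique_of_mem_Icc_left (v := fun _ => V)
      (s := fun _ => Metric.closedBall 0 (max R R')) (fun _ _ => hK) h.continuousOn (hd h)
      (fun t ht => hm t (Set.Ioc_subset_Icc_self ht)) h'.continuousOn (hd h')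
      (fun t ht => hm' t (Set.Ioc_subset_Icc_self ht)) he

/-- A curve in `ℓ¹` whose coordinates have the coordinates of a continuous curve as derivatives is
differentiable. -/
theorem hasDerivWithinAt_of_coord {w g : ℝ → L1} (hg : ContinuousOn g (Set.Icc 0 1))
    (h : ∀ s ∈ Set.Icc (0 : ℝ) 1, ∀ k : ℤ,
      HasDerivWithinAt (fun s' => (w s' : ℤ → ℂ) k) ((g s : ℤ → ℂ) k) (Set.Icc 0 1) s) :
    ∀ s ∈ Set.Icc (0 : ℝ) 1, HasDerivWithinAt w (g s) (Set.Icc 0 1) s := by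
  have h01 : (0 : ℝ) ≤ 1 := zero_le_one
  -- Constant extension beyond the interval makes the integrand continuous everywhere. The primitive
  -- `W` is then differentiable in norm, and it equals `w` since each coordinate of the difference
  -- has zero derivative.
  set G : ℝ → L1 := fun t => g (Set.projIcc 0 1 h01 t) with hG
  have hGc : Continuous G := 
    hg.comp_continuous (continuous_subtype_val.comp continuous_projIcc) fun t => Subtype.prop _
  have hGe : ∀ s ∈ Set.Icc (0 : ℝ) 1, G s = g s := fun s hs => by
    simp only [hG, Set.projIcc_of_mem h01 hs]
  set W : ℝ → L1 := fun s => w 0 + ∫ t in (0 : ℝ)..s, G t with hW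
  have hWd : ∀ s, HasDerivAt W (G s) s := fun s =>
    (intervalIntegral.integral_hasDerivAt_right (hGc.intervalIntegrable _ _)
      (hGc.stronglyMeasurableAtFilter _ _) hGc.continuousAt).const_add _
  have heq : ∀ s ∈ Set.Icc (0 : ℝ) 1, w s = W s := by
    intro s hs
    refine lp.ext (funext fun k => ?_)
    have hc : ∀ t ∈ Set.Icc (0 : ℝ) 1,
        HasDerivWithinAt (fun t => (w t : ℤ → ℂ) k - (W t : ℤ → ℂ) k) 0 (Set.Icc 0 1) t := by
      intro t ht
      have h1 := (lp.evalCLM ℝ (fun _ : ℤ => ℂ) 1 k).hasFDerivAt.comp_hasDerivAt t (hWd t)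
      have h2 := (h t ht k).sub h1.hasDerivWithinAt
      rw [hGe t ht] at h2
      convert! h2 using 1
      exact (sub_self _).symm
    have := (convex_Icc (0 : ℝ) 1).norm_image_sub_le_of_norm_hasDerivWithin_le (C := 0) hc
      (fun _ _ => by simp) (Set.left_mem_Icc.2 h01) hs
    simp only [zero_mul, norm_le_zero_iff] at this
    have h0 : W 0 = w 0 := by simp [hW]
    rw [h0, sub_self, sub_zero, sub_eq_zero] at this
    exact this
  intro s hs
  have := (hWd s).hasDerivWithinAt (s := Set.Icc 0 1)
  rw [hGe s hs] at this
  exact this.congr heq (heq s hs)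

variable {n : ℕ} {σ : Fin (n + 1) → Bool} {c : (Fin (n + 1) → ℤ) → ℝ}

/-! ### Conservation of the `ℓ²` norm -/

/-- Pairing with `conj (w x)` fills the empty slot `j` again and restores a complete form. -/
theorem hasSum_conj_mul_fieldTerm (hc : ∀ m, |c m| ≤ 1) (j : Fin (n + 1)) (w : L1) :
    HasSum (fun x => conj (w x) * fieldTerm σ c j w x) (ham (fun i => σ i == σ j) c w) := by
  have hs := summable_form (fun i => σ i == σ j) hc fun _ => w
  rw [← (Fin.insertNthEquiv (fun _ : Fin (n + 1) => ℤ) j).summable_iff] at hs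
  have h := hs.hasSum.prod_fiberwise fun x => (hs.prod_factor x).hasSum
  have e := (Fin.insertNthEquiv (fun _ : Fin (n + 1) => ℤ) j).tsum_eq
    fun m => (c m : ℂ) * ∏ i, cj (σ i == σ j) (w (m i))
  rw [ham, ← e]
  convert! h using 2 with x
  rw [fieldTerm, ← tsum_mul_left]
  refine tsum_congr fun y => ?_
  change _ = (c (j.insertNth x y) : ℂ) * ∏ i, cj (σ i == σ j)
    (w ((j.insertNth x y : Fin (n + 1) → ℤ) i))
  rw [Fin.prod_univ_succAbove _ j]
  simp only [Fin.insertNth_apply_same, Fin.insertNth_apply_succAbove, beq_self_eq_true, cj_true]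
  ring

theorem re_ham_eq (j : Fin (n + 1)) (v : ℤ → ℂ) :
    (ham (fun i => σ i == σ j) c v).re = (ham σ c v).re := by
  cases hj : σ j
  · have e : conj (ham σ c v) = ham (fun i => σ i == false) c v := by
      rw [ham, conj_tsum, ham]
      refine tsum_congr fun m => ?_
      simp only [map_mul, Complex.conj_ofReal, map_prod, conj_cj]
      congr! 3 with i
      cases σ i <;> rfl
    rw [← e, Complex.conj_re]
  · congr 2
    funext i
    cases σ i <;> rfl

/-- Each slot contributes `ham` or its conjugate, with the sign of the slot. The real parts agree,
so they cancel because the signs sum to zero. This is the infinitesimal form of `ℓ²` conservation.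
-/
theorem IsCoeff.hasSum_conj_mul_field (h : IsCoeff σ c) (w : L1) :
    ∃ z : ℂ, z.re = 0 ∧ HasSum (fun x => conj (w x) * h.weightedField le_rfl w x) z := by
  refine ⟨-∑ j, (sgn (σ j) : ℂ) * ham (fun i => σ i == σ j) c w, ?_, ?_⟩
  · have : ∀ j, ((sgn (σ j) : ℂ) * ham (fun i => σ i == σ j) c w).re
        = sgn (σ j) * (ham σ c w).re := fun j => by
      rw [← re_ham_eq j, ← Complex.ofReal_intCast, Complex.re_ofReal_mul]
    rw [Complex.neg_re, Complex.re_sum, Finset.sum_congr rfl fun j _ => this j, ← Finset.sum_mul]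
    have hb := h.balanced
    rw [show ∑ j, (sgn (σ j) : ℝ) = 0 by exact_mod_cast hb]
    simp
  · have := (hasSum_sum fun j (_ : j ∈ Finset.univ) =>
      (hasSum_conj_mul_fieldTerm (σ := σ) h.abs_le_one j w).mul_left (sgn (σ j) : ℂ)).neg
    convert! this using 2 with x
    rw [h.weightedField_zero_apply, field, mul_neg, Finset.mul_sum]
    congr 1
    exact Finset.sum_congr rfl fun j _ => by ring

/-- The coefficients of the form `∑ v(n) v̄(n)`. -/
def diagCoeff (m : Fin 2 → ℤ) : ℝ := if m 0 = m 1 then 1 else 0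

theorem abs_diagCoeff_le_one (m : Fin 2 → ℤ) : |diagCoeff m| ≤ 1 := by
  unfold diagCoeff
  split_ifs <;> simp

theorem form_diagCoeff (f : Fin 2 → L1) :
    form diagCoeff ![false, true] abs_diagCoeff_le_one f = ∑' x, f 0 x * conj (f 1 x) := by
  rw [form_apply]
  have hinj : Function.Injective fun x : ℤ => (![x, x] : Fin 2 → ℤ) := fun x y h => congrFun h 0
  rw [← hinj.tsum_eq]
  · simp [diagCoeff]
  · intro m hm
    have : m 0 = m 1 := by
      by_contra hne
      simp [diagCoeff, hne] at hm
    exact ⟨m 0, by funext i; fin_cases i <;> simp [this]⟩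

theorem summable_diag (f g : L1) : Summable fun x => f x * conj (g x) := by
  have h := summable_form ![false, true] abs_diagCoeff_le_one ![f, g]
  have hinj : Function.Injective fun x : ℤ => (![x, x] : Fin 2 → ℤ) := fun x y h => congrFun h 0
  simpa [diagCoeff, Function.comp_def] using h.comp_injective hinj

theorem IsCoeff.tsum_sq_eq (h : IsCoeff σ c) {w : ℝ → L1}
    (hw : IsCurve (h.weightedField le_rfl) w) :
    ∑' x, w 1 x * conj (w 1 x) = ∑' x, w 0 x * conj (w 0 x) := by
  have hd : ∀ t ∈ Set.Icc (0 : ℝ) 1, HasDerivWithinAt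
      (fun t => form diagCoeff ![false, true] abs_diagCoeff_le_one fun _ => w t) 0
      (Set.Icc 0 1) t := by
    intro t ht
    have hp : HasDerivWithinAt (fun t => fun _ : Fin 2 => w t)
        (fun _ => h.weightedField le_rfl (w t)) (Set.Icc 0 1) t :=
      hasDerivWithinAt_pi.2 fun _ => hw t ht
    have h1 := (ContinuousMultilinearMap.hasFDerivAt
      (form diagCoeff ![false, true] abs_diagCoeff_le_one)
      (fun _ => w t)).comp_hasDerivWithinAt t hp
    convert! h1 using 1
    obtain ⟨z, hz, hs⟩ := h.hasSum_conj_mul_field (w t)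
    set V := h.weightedField le_rfl (w t)
    rw [ContinuousMultilinearMap.linearDeriv_apply, Fin.sum_univ_two, form_diagCoeff,
      form_diagCoeff]
    simp only [Function.update_self, Function.update_of_ne (zero_ne_one' (Fin 2)),
      Function.update_of_ne (one_ne_zero' (Fin 2))]
    have e1 : ∑' x, V x * conj (w t x) = z := by
      rw [← hs.tsum_eq]
      exact tsum_congr fun x => mul_comm _ _
    have e2 : ∑' x, w t x * conj (V x) = conj z := by
      rw [← hs.tsum_eq, conj_tsum]
      exact tsum_congr fun x => by rw [map_mul, Complex.conj_conj]
    rw [e1, e2, Complex.add_conj, hz]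
    simp
  have := (convex_Icc (0 : ℝ) 1).norm_image_sub_le_of_norm_hasDerivWithin_le (C := 0) hd
      (fun _ _ => by simp) (Set.left_mem_Icc.2 zero_le_one) (Set.right_mem_Icc.2 zero_le_one)
  simp only [zero_mul, norm_le_zero_iff, sub_eq_zero] at this
  rwa [form_diagCoeff, form_diagCoeff] at this

theorem ellNorm_two_zero (v : L1) :
    ellNorm 2 0 v = (ENNReal.ofReal (∑' x, v x * conj (v x)).re) ^ (1 / 2 : ℝ) := by
  rw [ellNorm, MeasureTheory.eLpNorm_eq_lintegral_rpow_enorm_toReal (by simp) (by simp),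
    MeasureTheory.lintegral_count, Complex.re_tsum (summable_diag v v),
    ENNReal.ofReal_tsum_of_nonneg]
  · congr 1
    refine tsum_congr fun x => ?_
    rw [Complex.mul_conj, Complex.ofReal_re, Complex.normSq_eq_norm_sq, ← ofReal_norm]
    simp
  · intro x
    rw [Complex.mul_conj, Complex.ofReal_re]
    exact Complex.normSq_nonneg _
  · have := (Complex.reCLM.hasSum (summable_diag v v).hasSum).summable
    simpa using! this

/-! ### The time-one map in terms of integral curves -/

/-- The field is continuous on `ℓ¹`, so along a continuous curve the coordinatewise equations amount
to differentiability in norm (`hasDerivWithinAt_of_coord`). -/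
theorem timeOne_iff (h : IsCoeff σ c) (v u : ℤ → ℂ) :
    TimeOne (fun v => ham σ c v - conj (ham σ c v)) v u ↔
      ∃ w : ℝ → L1, IsCurve (h.weightedField le_rfl) w ∧ ⇑(w 0) = v ∧ ⇑(w 1) = u := by
  constructor
  · rintro ⟨w, hc, h0, h1, hd⟩
    refine ⟨w, ?_, h0, h1⟩
    refine hasDerivWithinAt_of_coord
      ((h.lipOnBalls_weightedField le_rfl).continuous.comp_continuousOn hc) fun s hs k => ?_
    rw [h.weightedField_zero_apply, ← dbar_ham h.abs_le_one]
    exact hd s hs k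
  · rintro ⟨w, hw, h0, h1⟩
    refine ⟨w, hw.continuousOn, h0, h1, fun s hs k => ?_⟩
    rw [dbar_ham h.abs_le_one, ← h.weightedField_zero_apply]
    exact (lp.evalCLM ℝ (fun _ : ℤ => ℂ) 1 k).hasFDerivAt.comp_hasDerivWithinAt s (hw s hs)

theorem timeOne_unique (h : IsCoeff σ c) {v u u' : ℤ → ℂ}
    (hu : TimeOne (fun v => ham σ c v - conj (ham σ c v)) v u)
    (hu' : TimeOne (fun v => ham σ c v - conj (ham σ c v)) v u') : u = u' := by
  obtain ⟨w, hw, h0, rfl⟩ := (timeOne_iff h v u).1 hu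
  obtain ⟨w', hw', h0', rfl⟩ := (timeOne_iff h v u').1 hu'
  rw [hw.eqOn (h.lipOnBalls_weightedField le_rfl) hw' (.inl (lp.ext (h0.trans h0'.symm)))
    (Set.right_mem_Icc.2 zero_le_one)]

theorem timeOne_injective (h : IsCoeff σ c) {v v' u : ℤ → ℂ}
    (hu : TimeOne (fun v => ham σ c v - conj (ham σ c v)) v u)
    (hu' : TimeOne (fun v => ham σ c v - conj (ham σ c v)) v' u) : v = v' := by
  obtain ⟨w, hw, rfl, h1⟩ := (timeOne_iff h v u).1 hu
  obtain ⟨w', hw', rfl, h1'⟩ := (timeOne_iff h v' u).1 hu'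
  rw [hw.eqOn (h.lipOnBalls_weightedField le_rfl) hw' (.inr (lp.ext (h1.trans h1'.symm)))
    (Set.left_mem_Icc.2 zero_le_one)]

theorem timeOne_ellNorm_two (h : IsCoeff σ c) {v u : ℤ → ℂ}
    (hu : TimeOne (fun v => ham σ c v - conj (ham σ c v)) v u) : ellNorm 2 0 u = ellNorm 2 0 v := by
  obtain ⟨w, hw, rfl, rfl⟩ := (timeOne_iff h v u).1 hu
  rw [ellNorm_two_zero, ellNorm_two_zero, h.tsum_sq_eq hw]

/-! ### The two Hamiltonians -/

/-- The flags of the conjugated slots of `F₁`. -/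
def quarticFlag : Fin 4 → Bool := ![false, false, true, true]

/-- The flags of the conjugated slots of `F₂`. -/
def sexticFlag : Fin 6 → Bool := ![false, false, false, true, true, true]

theorem isCoeff_quartic : IsCoeff quarticFlag quarticCoeff where
  abs_le_one := abs_quarticCoeff_le_one
  sum_eq_zero m hm := by
    have := quarticCoeff_ne_zero hm
    simp [Fin.sum_univ_succ, quarticFlag, sgn]
    linarith
  balanced := by decide

theorem isCoeff_sextic : IsCoeff sexticFlag sexticCoeff where
  abs_le_one := abs_sexticCoeff_le_one
  sum_eq_zero m hm := by
    have := (sexticCoeff_ne_zero hm).2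
    simp [Fin.sum_univ_succ, sexticFlag, sgn]
    linarith
  balanced := by decide

/-- Tuples as functions on `Fin 4`. -/
def tupleEquivFour : ℤ × ℤ × ℤ × ℤ ≃ (Fin 4 → ℤ) where
  toFun p := ![p.1, p.2.1, p.2.2.1, p.2.2.2]
  invFun m := (m 0, m 1, m 2, m 3)
  left_inv _ := rfl
  right_inv m := by funext i; fin_cases i <;> rfl

/-- Tuples as functions on `Fin 6`. -/
def tupleEquivSix : ℤ × ℤ × ℤ × ℤ × ℤ × ℤ ≃ (Fin 6 → ℤ) where
  toFun p := ![p.1, p.2.1, p.2.2.1, p.2.2.2.1, p.2.2.2.2.1, p.2.2.2.2.2]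
  invFun m := (m 0, m 1, m 2, m 3, m 4, m 5)
  left_inv _ := rfl
  right_inv m := by funext i; fin_cases i <;> rfl

theorem sexticTerm_eq (v : ℤ → ℂ) (p : ℤ × ℤ × ℤ × ℤ × ℤ × ℤ) :
    sexticTerm v p = (sexticCoeff (tupleEquivSix p) : ℂ) *
      ∏ i, cj (sexticFlag i) (v (tupleEquivSix p i)) := by
  obtain ⟨m₁, m₂, m₃, m₄, m₅, m₆⟩ := p
  have e : tupleEquivSix (m₁, m₂, m₃, m₄, m₅, m₆) = ![m₁, m₂, m₃, m₄, m₅, m₆] := rfl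
  have ec : sexticCoeff ![m₁, m₂, m₃, m₄, m₅, m₆] =
      if (m₄ ≠ m₁ ∧ m₅ ≠ m₁ ∧ m₂ ≠ m₆ ∧ m₃ ≠ m₆) ∧ m₁ + m₂ + m₃ - m₄ - m₅ - m₆ = 0 ∧
        m₁ ^ 2 + m₂ ^ 2 + m₃ ^ 2 - m₄ ^ 2 - m₅ ^ 2 - m₆ ^ 2 ≠ 0 then
      (((m₁ ^ 2 + m₂ ^ 2 + m₃ ^ 2 - m₄ ^ 2 - m₅ ^ 2 - m₆ ^ 2)
        * (m₂ - m₆) * (m₆ - m₃) : ℤ) : ℝ)⁻¹ else 0 := rfl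
  rw [e, ec, Fin.prod_univ_six]
  simp only [sexticTerm, sexticFlag, Matrix.cons_val, cj_true, cj_false]
  split_ifs
  · push_cast
    ring
  · simp

theorem F₂_eq : F₂ = fun v => ham sexticFlag sexticCoeff v - conj (ham sexticFlag sexticCoeff v) := by
  funext v
  have : ∑' m, sexticTerm v m = ham sexticFlag sexticCoeff v := by
    rw [ham, ← tupleEquivSix.tsum_eq]
    exact tsum_congr fun p => sexticTerm_eq v p
  rw [F₂, this]

theorem quarticTerm_eq (v : ℤ → ℂ) (p : ℤ × ℤ × ℤ × ℤ) :
    quarticTerm v p = 2 * ((quarticCoeff (tupleEquivFour p) : ℂ) *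
      ∏ i, cj (quarticFlag i) (v (tupleEquivFour p i))) := by
  obtain ⟨m₁, m₂, m₃, m₄⟩ := p
  have e : tupleEquivFour (m₁, m₂, m₃, m₄) = ![m₁, m₂, m₃, m₄] := rfl
  have ec : quarticCoeff ![m₁, m₂, m₃, m₄] =
      if m₁ + m₂ - m₃ - m₄ = 0 ∧ m₁ ^ 2 + m₂ ^ 2 - m₃ ^ 2 - m₄ ^ 2 ≠ 0 then
      (2 * ((m₁ ^ 2 + m₂ ^ 2 - m₃ ^ 2 - m₄ ^ 2 : ℤ) : ℝ))⁻¹ else 0 := rfl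
  rw [e, ec, Fin.prod_univ_four]
  simp only [quarticTerm, quarticFlag, Matrix.cons_val, cj_true, cj_false]
  split_ifs
  · push_cast
    rw [mul_inv]
    ring
  · simp

theorem conj_quarticTerm (v : ℤ → ℂ) (m₁ m₂ m₃ m₄ : ℤ) :
    conj (quarticTerm v (m₁, m₂, m₃, m₄)) = -quarticTerm v (m₃, m₄, m₁, m₂) := by
  simp only [quarticTerm]
  have e : (m₁ + m₂ - m₃ - m₄ = 0 ∧ m₁ ^ 2 + m₂ ^ 2 - m₃ ^ 2 - m₄ ^ 2 ≠ 0) ↔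
      (m₃ + m₄ - m₁ - m₂ = 0 ∧ m₃ ^ 2 + m₄ ^ 2 - m₁ ^ 2 - m₂ ^ 2 ≠ 0) := by
    constructor <;> rintro ⟨h1, h2⟩ <;> exact ⟨by linarith, fun h => h2 (by linarith)⟩
  by_cases h : m₁ + m₂ - m₃ - m₄ = 0 ∧ m₁ ^ 2 + m₂ ^ 2 - m₃ ^ 2 - m₄ ^ 2 ≠ 0
  · rw [if_pos h, if_pos (e.1 h), ← div_neg]
    simp only [map_div₀, map_mul, Complex.conj_conj, map_intCast]
    congr 1
    · ring
    · push_cast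
      ring
  · rw [if_neg h, if_neg (mt e.2 h)]
    simp

/-- Exchanging the two pairs of indices changes the sign of the denominator, so `F₁` is purely
imaginary and equals half of `F₁ - conj F₁`; hence the halved coefficients. -/
theorem F₁_eq :
    F₁ = fun v => ham quarticFlag quarticCoeff v - conj (ham quarticFlag quarticCoeff v) := by
  funext v
  have e : F₁ v = 2 * ham quarticFlag quarticCoeff v := by
    rw [F₁, ham, ← tsum_mul_left, ← tupleEquivFour.tsum_eq]
    exact tsum_congr fun p => quarticTerm_eq v p
  have hc : conj (F₁ v) = -F₁ v := by
    let s : ℤ × ℤ × ℤ × ℤ ≃ ℤ × ℤ × ℤ × ℤ :=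
      { toFun := fun p => (p.2.2.1, p.2.2.2, p.1, p.2.1)
        invFun := fun p => (p.2.2.1, p.2.2.2, p.1, p.2.1)
        left_inv := fun _ => rfl
        right_inv := fun _ => rfl }
    rw [F₁, conj_tsum, ← s.tsum_eq, ← tsum_neg]
    exact tsum_congr fun p => conj_quarticTerm v _ _ _ _
  rw [e, map_mul, Complex.conj_ofNat] at hc
  rw [e]
  linear_combination (1 / 2) * hc

/-! ### The two-parameter bound that defines `B^δ_{ε,C}` -/

/-- The bounds `R / l` on the sum and `R l` on the supremum. -/
def MBound (l R : ℝ) (w : ℤ → ℂ) : Prop :=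
  ∑' k, ‖w k‖ₑ ≤ ENNReal.ofReal (R / l) ∧ ∀ k, ‖w k‖ₑ ≤ ENNReal.ofReal (R * l)

theorem MBound.mono {l R R' : ℝ} (hl : 0 < l) (hR : R ≤ R') {w : ℤ → ℂ} (h : MBound l R w) :
    MBound l R' w :=
  ⟨h.1.trans (ENNReal.ofReal_le_ofReal (by gcongr)),
    fun k => (h.2 k).trans (ENNReal.ofReal_le_ofReal (by gcongr))⟩

/-! ### The vector field on sequences with small supremum -/

section FieldBound

variable {n : ℕ} {σ : Fin (n + 1) → Bool} {c : (Fin (n + 1) → ℤ) → ℝ}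

/-- The indicator function of the support of `c`. -/
def suppWeight {N : ℕ} (c : (Fin N → ℤ) → ℝ) (m : Fin N → ℤ) : ℝ≥0∞ := if c m = 0 then 0 else 1

theorem suppWeight_le_one {N : ℕ} (c : (Fin N → ℤ) → ℝ) (m : Fin N → ℤ) : suppWeight c m ≤ 1 := by
  unfold suppWeight
  split_ifs <;> simp

theorem IsCoeff.tsum_suppWeight_le_one (h : IsCoeff σ c) (j : Fin (n + 1)) (y : Fin n → ℤ) :
    ∑' x : ℤ, suppWeight c (j.insertNth x y) ≤ 1 := by
  by_cases hx : ∃ x, c (j.insertNth x y) ≠ 0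
  · obtain ⟨x, hx⟩ := hx
    rw [tsum_eq_single x]
    · exact suppWeight_le_one _ _
    · intro x' hx'
      rw [suppWeight, if_pos]
      by_contra hne
      exact hx' (h.eq_of_ne_zero hne hx)
  · push Not at hx
    simp [suppWeight, hx]

theorem IsCoeff.tsum_suppWeight_le (h : IsCoeff σ c) (j : Fin (n + 1)) {f : ℤ → ℝ≥0∞} {a : ℝ≥0∞}
    (ha : ∑' x, f x ≤ a) :
    ∑' (x : ℤ) (y : Fin n → ℤ), suppWeight c (j.insertNth x y) * ∏ i, f (y i) ≤ a ^ n := by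
  rw [ENNReal.tsum_comm]
  simp_rw [ENNReal.tsum_mul_right]
  calc _ ≤ ∑' y : Fin n → ℤ, ∏ i, f (y i) :=
        ENNReal.tsum_le_tsum fun y => mul_le_of_le_one_left' (h.tsum_suppWeight_le_one j y)
    _ = (∑' x, f x) ^ n := by rw [tsum_pi_prod fun _ => f]; simp
    _ ≤ a ^ n := by gcongr

/-- For a fixed output the linear relation determines the first input from the others; it is bounded
by the supremum and the others are summed. -/
theorem IsCoeff.tsum_suppWeight_fiber_le {n : ℕ} {σ : Fin (n + 1 + 1) → Bool}
    {c : (Fin (n + 1 + 1) → ℤ) → ℝ} (h : IsCoeff σ c) (j : Fin (n + 1 + 1)) {f : ℤ → ℝ≥0∞}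
    {a b : ℝ≥0∞} (ha : ∑' x, f x ≤ a) (hb : ∀ x, f x ≤ b) (x : ℤ) :
    ∑' y : Fin (n + 1) → ℤ, suppWeight c (j.insertNth x y) * ∏ i, f (y i) ≤ b * a ^ n := by
  have hsupp : ∀ y ∈ Function.support fun y : Fin (n + 1) → ℤ =>
      suppWeight c (j.insertNth x y) * ∏ i, f (y i), c (j.insertNth x y) ≠ 0 := by
    intro y hy h0
    simp [suppWeight, h0] at hy
  refine (tsum_le_tsum_of_injOn (Fin.tail : (Fin (n + 1) → ℤ) → Fin n → ℤ)
    (G := fun y => b * ∏ i, f (y i)) ?_ ?_).trans ?_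
  · intro y hy y' hy' e
    have h1 := h.sgn_mul_eq (hsupp y hy)
    rw [h.sgn_mul_eq (hsupp y' hy')] at h1
    have e' : ∀ i : Fin n, y i.succ = y' i.succ := fun i => congrFun e i
    simp only [Fin.sum_univ_succ, e', neg_inj, add_left_inj] at h1
    have h0 : y 0 = y' 0 := by
      refine mul_left_cancel₀ ?_ h1.symm
      cases σ (j.succAbove 0) <;> simp [sgn]
    funext i
    exact Fin.cases h0 e' i
  · intro y _
    rw [Fin.prod_univ_succ]
    refine (mul_le_of_le_one_left' (suppWeight_le_one c _)).trans ?_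
    gcongr
    · exact hb _
    · exact le_of_eq rfl
  · rw [ENNReal.tsum_mul_left, tsum_pi_prod fun _ => f]
    simp only [Finset.prod_const, Finset.card_univ, Fintype.card_fin]
    gcongr

/-- Either `|t| ≤ ε ^ q`, or `|t| ^ (γ / q) ≥ ε ^ γ` and the first term alone suffices. -/
theorem enorm_le_rpow_add {t ε γ : ℝ} {q : ℕ} (hε : 0 < ε) (hγ : 0 < γ) (hq : q ≠ 0) :
    ‖t‖ₑ ≤ ENNReal.ofReal (ε ^ (-γ)) * ‖t‖ₑ ^ (1 + γ / q)
      + ENNReal.ofReal (ε ^ q) * (if t = 0 then 0 else 1) := by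
  by_cases h0 : t = 0
  · simp [h0]
  rw [if_neg h0, mul_one]
  have hp : 0 < |t| := abs_pos.2 h0
  rw [Real.enorm_eq_ofReal_abs, ENNReal.ofReal_rpow_of_pos hp,
    ← ENNReal.ofReal_mul (by positivity), ← ENNReal.ofReal_add (by positivity) (by positivity)]
  refine ENNReal.ofReal_le_ofReal ?_
  rcases le_total |t| (ε ^ q) with hle | hle
  · have : 0 ≤ ε ^ (-γ) * |t| ^ (1 + γ / q) := by positivity
    linarith
  · have e1 : (ε ^ q) ^ (γ / q) = ε ^ γ := by
      rw [← Real.rpow_natCast, ← Real.rpow_mul hε.le, mul_div_cancel₀]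
      exact_mod_cast hq
    have h1 : ε ^ γ ≤ |t| ^ (γ / q) := by
      rw [← e1]
      exact Real.rpow_le_rpow (by positivity) hle (by positivity)
    have h2 : ε ^ (-γ) * ε ^ γ = 1 := by rw [← Real.rpow_add hε]; simp
    rw [Real.rpow_add hp, Real.rpow_one]
    have h3 : |t| ≤ ε ^ (-γ) * (|t| * |t| ^ (γ / q)) :=
      calc |t| = ε ^ (-γ) * (|t| * ε ^ γ) := by linear_combination (-|t|) * h2
        _ ≤ _ := by gcongr
    have : 0 ≤ ε ^ q := by positivity
    linarith

theorem enorm_coeff_le {N : ℕ} (c : (Fin N → ℤ) → ℝ) {ε γ : ℝ} {q : ℕ} (hε : 0 < ε) (hγ : 0 < γ)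
    (hq : q ≠ 0) (m : Fin N → ℤ) :
    ‖c m‖ₑ ≤ ENNReal.ofReal (ε ^ (-γ)) * ‖c m‖ₑ ^ (1 + γ / q)
      + ENNReal.ofReal (ε ^ q) * suppWeight c m :=
  enorm_le_rpow_add hε hγ hq

/-- Here `l ^ 2 = ε` and `G = ε^(-γ)`. Apart from `G` and `K`, both terms equal `R ^ (2 * p + 3) *
l`: the cutoff exponent `p + 2` is just large enough for the trivial bound on the small
coefficients. -/
theorem mbound_aux_sum {l K R G : ℝ} (p : ℕ) (hl : 0 < l) (hR : 0 ≤ R) (hG : 1 ≤ G) :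
    G * (K * (R / l) ^ (p + 1) * (R * l) ^ (p + 2)) + (l ^ 2) ^ (p + 2) * (R / l) ^ (2 * p + 3)
      ≤ (K + 1) * (l ^ 2 * G) * R ^ (2 * p + 3) / l := by
  have e : G * (K * (R / l) ^ (p + 1) * (R * l) ^ (p + 2))
      + (l ^ 2) ^ (p + 2) * (R / l) ^ (2 * p + 3) = (G * K + 1) * (R ^ (2 * p + 3) * l) := by
    obtain ⟨a, rfl⟩ : ∃ a, R = a * l := ⟨R / l, by field_simp⟩
    rw [mul_div_cancel_right₀ _ hl.ne']
    ring
  have e' : (K + 1) * (l ^ 2 * G) * R ^ (2 * p + 3) / l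
      = (G * K + G) * (R ^ (2 * p + 3) * l) := by
    field_simp
  rw [e, e']
  gcongr

theorem mbound_aux_sup {l K R G : ℝ} (p : ℕ) (hl : 0 < l) (hR : 0 ≤ R) (hG : 1 ≤ G) :
    G * (K * (R / l) ^ p * (R * l) ^ (p + 3))
      + (l ^ 2) ^ (p + 2) * ((R * l) * (R / l) ^ (2 * p + 2))
      ≤ (K + 1) * (l ^ 2 * G) * R ^ (2 * p + 3) * l := by
  have e : G * (K * (R / l) ^ p * (R * l) ^ (p + 3))
      + (l ^ 2) ^ (p + 2) * ((R * l) * (R / l) ^ (2 * p + 2))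
      = (G * K + 1) * (R ^ (2 * p + 3) * l ^ 3) := by
    obtain ⟨a, rfl⟩ : ∃ a, R = a * l := ⟨R / l, by field_simp⟩
    rw [mul_div_cancel_right₀ _ hl.ne']
    ring
  have e' : (K + 1) * (l ^ 2 * G) * R ^ (2 * p + 3) * l
      = (G * K + G) * (R ^ (2 * p + 3) * l ^ 3) := by ring
  rw [e, e']
  gcongr

end FieldBound

section

variable {p : ℕ} {σ : Fin (2 * p + 3 + 1) → Bool} {c : (Fin (2 * p + 3 + 1) → ℤ) → ℝ}

/-- Of the `2 * p + 3` inputs, the `ℓ¹` bound uses `p + 1` sums and `p + 2` suprema (`Z'` avoids the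
output), the supremum bound `p` sums and `p + 3` suprema (`Z` contains it). Either way a factor `ε`
is left over relative to the bounds on `w`. -/
theorem IsCoeff.exists_slot_bound (h : IsCoeff σ c) (hd : Dispersive c p) {γ : ℝ} (hγ : 0 < γ) :
    ∃ K : ℝ, 0 ≤ K ∧ ∀ ε ∈ Set.Ioo (0 : ℝ) 1, ∀ R : ℝ, 0 ≤ R → ∀ w : ℤ → ℂ,
      MBound (√ε) R w → ∀ j : Fin (2 * p + 3 + 1),
      ∑' (x : ℤ) (y : Fin (2 * p + 3) → ℤ), ‖c (j.insertNth x y)‖ₑ * ∏ i, ‖w (y i)‖ₑ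
        ≤ ENNReal.ofReal (K * ε ^ (1 - γ) * R ^ (2 * p + 3) / √ε) ∧
      ∀ x, ∑' y : Fin (2 * p + 3) → ℤ, ‖c (j.insertNth x y)‖ₑ * ∏ i, ‖w (y i)‖ₑ
        ≤ ENNReal.ofReal (K * ε ^ (1 - γ) * R ^ (2 * p + 3) * √ε) := by
  have hr : 1 < 1 + γ / (p + 2 : ℕ) := by
    have : 0 < γ / (p + 2 : ℕ) := by positivity
    linarith
  obtain ⟨K, hK, hZ⟩ := hd _ hr
  lift K to NNReal using hK
  refine ⟨K + 1, by positivity, fun ε hε R hR w hw j => ?_⟩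
  obtain ⟨⟨Z, hj, hZc, hZs⟩, ⟨Z', hj', hZc', hZs'⟩⟩ := hZ j
  have hl : 0 < √ε := Real.sqrt_pos.2 hε.1
  have hsq : √ε ^ 2 = ε := Real.sq_sqrt hε.1.le
  have hG : 1 ≤ ε ^ (-γ) :=
    Real.one_le_rpow_of_pos_of_le_one_of_nonpos hε.1 hε.2.le (by linarith)
  have hεγ : ε ^ (1 - γ) = √ε ^ 2 * ε ^ (-γ) := by
    rw [hsq, sub_eq_add_neg, Real.rpow_add hε.1, Real.rpow_one]
  have hpt : ∀ (x : ℤ) (y : Fin (2 * p + 3) → ℤ),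
      ‖c (j.insertNth x y)‖ₑ * ∏ i, ‖w (y i)‖ₑ
      ≤ ENNReal.ofReal (ε ^ (-γ)) * (‖c (j.insertNth x y)‖ₑ ^ (1 + γ / (p + 2 : ℕ)) *
          ∏ i, ‖w (y i)‖ₑ)
        + ENNReal.ofReal (ε ^ (p + 2)) * (suppWeight c (j.insertNth x y) * ∏ i, ‖w (y i)‖ₑ) := by
    intro x y
    rw [← mul_assoc, ← mul_assoc, ← add_mul]
    gcongr
    exact enorm_coeff_le c hε.1 hγ (by omega) _
  constructor
  · refine (ENNReal.tsum_le_tsum fun x => ENNReal.tsum_le_tsum fun y => hpt x y).trans ?_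
    simp only [ENNReal.tsum_add, ENNReal.tsum_mul_left]
    refine (add_le_add (mul_le_mul_right (hZs'.tsum_le hj' hw.1 hw.2) _)
      (mul_le_mul_right (h.tsum_suppWeight_le j hw.1) _)).trans ?_
    rw [hZc', show 2 * p + 3 - (p + 1) = p + 2 by omega, ← ENNReal.ofReal_coe_nnreal,
      ← ENNReal.ofReal_pow (by positivity), ← ENNReal.ofReal_pow (by positivity),
      ← ENNReal.ofReal_pow (by positivity), ← ENNReal.ofReal_mul (by positivity),
      ← ENNReal.ofReal_mul (by positivity), ← ENNReal.ofReal_mul (by positivity),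
      ← ENNReal.ofReal_mul (by have := hε.1; positivity),
      ← ENNReal.ofReal_add (by positivity) (by have := hε.1; positivity), hεγ]
    refine ENNReal.ofReal_le_ofReal ?_
    have := mbound_aux_sum (K := K) p hl hR hG
    rwa [hsq] at this ⊢
  · intro x
    refine (ENNReal.tsum_le_tsum fun y => hpt x y).trans ?_
    simp only [ENNReal.tsum_add, ENNReal.tsum_mul_left]
    refine (add_le_add (mul_le_mul_right (hZs.tsum_le_of_mem hj hw.1 hw.2 x) _)
      (mul_le_mul_right (h.tsum_suppWeight_fiber_le j hw.1 hw.2 x) _)).trans ?_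
    rw [hZc, show 2 * p + 3 + 1 - (p + 1) = p + 3 by omega, Nat.add_sub_cancel,
      ← ENNReal.ofReal_coe_nnreal,
      ← ENNReal.ofReal_pow (by positivity), ← ENNReal.ofReal_pow (by positivity),
      ← ENNReal.ofReal_pow (by positivity), ← ENNReal.ofReal_mul (by positivity),
      ← ENNReal.ofReal_mul (by positivity), ← ENNReal.ofReal_mul (by positivity),
      ← ENNReal.ofReal_mul (by positivity), ← ENNReal.ofReal_mul (by have := hε.1; positivity),
      ← ENNReal.ofReal_add (by positivity) (by have := hε.1; positivity), hεγ]
    refine ENNReal.ofReal_le_ofReal ?_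
    have := mbound_aux_sup (K := K) p hl hR hG
    rwa [hsq] at this ⊢

theorem enorm_neg_sum_sgn_le {N : ℕ} (b : Fin N → Bool) (z : Fin N → ℂ) :
    ‖-∑ j, (sgn (b j) : ℂ) * z j‖ₑ ≤ ∑ j, ‖z j‖ₑ := by
  rw [enorm_neg]
  refine (enorm_sum_le _ _).trans (Finset.sum_le_sum fun j _ => ?_)
  cases b j <;> simp [sgn]

/-- The field gains the factor `ε^{1-γ}` on sequences with the bounds of `B^δ_{ε,R}`. -/
theorem IsCoeff.exists_field_bound (h : IsCoeff σ c) (hd : Dispersive c p) {γ : ℝ} (hγ : 0 < γ) :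
    ∃ K : ℝ, 0 ≤ K ∧ ∀ ε ∈ Set.Ioo (0 : ℝ) 1, ∀ (δ : ℝ) (hδ : 0 ≤ δ) (R : ℝ), 0 ≤ R → ∀ w : L1,
      MBound (√ε) R w →
      MBound (√ε) (K * ε ^ (1 - γ) * R ^ (2 * p + 3)) (h.weightedField hδ w) := by
  obtain ⟨K, hK0, hK⟩ := h.exists_slot_bound hd hγ
  refine ⟨(2 * p + 3 + 1 : ℕ) * K, by positivity, fun ε hε δ hδ R hR w hw => ?_⟩
  have hb : ∀ x, ‖h.weightedField hδ w x‖ₑ ≤ ∑ j : Fin (2 * p + 3 + 1),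
      ∑' y : Fin (2 * p + 3) → ℤ, ‖c (j.insertNth x y)‖ₑ * ∏ i, ‖w (y i)‖ₑ := by
    intro x
    rw [h.weightedField_apply]
    refine (enorm_neg_sum_sgn_le _ _).trans (Finset.sum_le_sum fun j _ => ?_)
    refine (enorm_tsum_le _).trans (ENNReal.tsum_le_tsum fun y => ?_)
    rw [enorm_mul, enorm_prod_cj]
    gcongr
    exact h.enorm_weightedKernel_le hδ j x y
  have hsum : ∀ {t : ℝ}, 0 ≤ t → ∑ _j : Fin (2 * p + 3 + 1), ENNReal.ofReal t
      = ENNReal.ofReal ((2 * p + 3 + 1 : ℕ) * t) := by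
    intro t ht
    rw [Finset.sum_const, Finset.card_univ, Fintype.card_fin, nsmul_eq_mul,
      ENNReal.ofReal_mul (by positivity), ENNReal.ofReal_natCast]
  have hε0 := hε.1
  constructor
  · refine (ENNReal.tsum_le_tsum hb).trans ?_
    rw [Summable.tsum_finsetSum fun _ _ => ENNReal.summable]
    refine (Finset.sum_le_sum fun j _ => (hK ε hε R hR w hw j).1).trans ?_
    rw [hsum (by positivity)]
    exact ENNReal.ofReal_le_ofReal (le_of_eq (by ring))
  · intro x
    refine (hb x).trans ((Finset.sum_le_sum fun j _ => (hK ε hε R hR w hw j).2 x).trans ?_)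
    rw [hsum (by positivity)]
    exact ENNReal.ofReal_le_ofReal (le_of_eq (by ring))

end

/-! ### `ℓ¹` with the norm `max (l ‖w‖₁) (‖w‖_∞ / l)` -/

/-- Bounded sequences. -/
abbrev LInf : Type := lp (fun _ : ℤ => ℂ) ∞

/-- The pairs `(l w, w / l)`, with the norm of `ℓ¹ × ℓ^∞`. -/
def TwoNorm (l : ℝ) : Submodule ℝ (L1 × LInf) where
  carrier := {x | ∀ k, x.1 k = ((l ^ 2 : ℝ) : ℂ) * x.2 k}
  add_mem' {x y} hx hy k := by
    change x.1 k + y.1 k = _ * (x.2 k + y.2 k)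
    rw [hx k, hy k]
    ring
  zero_mem' k := by
    change (0 : ℂ) = _ * 0
    simp
  smul_mem' a x hx k := by
    change a • x.1 k = _ * (a • x.2 k)
    rw [hx k, mul_smul_comm]

theorem isClosed_twoNorm (l : ℝ) : IsClosed (TwoNorm l : Set (L1 × LInf)) := by
  have : (TwoNorm l : Set (L1 × LInf)) = ⋂ k : ℤ,
      {x | lp.evalCLM ℝ (fun _ : ℤ => ℂ) 1 k x.1
        = ((l ^ 2 : ℝ) : ℂ) * lp.evalCLM ℝ (fun _ : ℤ => ℂ) ∞ k x.2} := by
    ext x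
    simp only [Set.mem_iInter, Set.mem_ofPred_eq]
    rfl
  rw [this]
  exact isClosed_iInter fun k => isClosed_eq (by fun_prop) (by fun_prop)

instance (l : ℝ) : CompleteSpace (TwoNorm l) := (isClosed_twoNorm l).completeSpace_coe

/-- The inclusion of `ℓ¹` in `ℓ^∞`. -/
def inclInf : L1 →L[ℝ] LInf :=
  (lp.linearMapOfLE ℝ (fun _ : ℤ => ℂ) (p := 1) (q := ∞) le_top).mkContinuous 1 fun f => by
    rw [one_mul]
    exact lp.norm_le_of_forall_le (norm_nonneg _) fun k => lp.norm_apply_le_norm one_ne_zero f k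

/-- The map `w ↦ (l w, w / l)`. -/
def toTwoNorm (l : ℝ) (hl : 0 < l) : L1 →L[ℝ] TwoNorm l :=
  ((l • ContinuousLinearMap.id ℝ L1).prod (l⁻¹ • inclInf)).codRestrict (TwoNorm l) fun w k => by
    change l • w k = _ * (l⁻¹ • w k)
    rw [Complex.real_smul, Complex.real_smul, ← mul_assoc, ← Complex.ofReal_mul]
    congr 2
    field_simp

/-- The inverse of `toTwoNorm`. -/
def ofTwoNorm (l : ℝ) : TwoNorm l →L[ℝ] L1 :=
  l⁻¹ • (ContinuousLinearMap.fst ℝ L1 LInf).comp (TwoNorm l).subtypeL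

theorem ofTwoNorm_toTwoNorm {l : ℝ} (hl : 0 < l) (w : L1) : ofTwoNorm l (toTwoNorm l hl w) = w := by
  change l⁻¹ • l • w = w
  rw [smul_smul, inv_mul_cancel₀ hl.ne', one_smul]

theorem toTwoNorm_ofTwoNorm {l : ℝ} (hl : 0 < l) (x : TwoNorm l) :
    toTwoNorm l hl (ofTwoNorm l x) = x := by
  have h1 : l • l⁻¹ • x.1.1 = x.1.1 := by rw [smul_smul, mul_inv_cancel₀ hl.ne', one_smul]
  refine Subtype.ext (Prod.ext h1 (lp.ext (funext fun k => ?_)))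
  change l⁻¹ • l⁻¹ • x.1.1 k = x.1.2 k
  rw [x.2 k, Complex.real_smul, Complex.real_smul]
  push_cast
  have : (l : ℂ) ≠ 0 := by exact_mod_cast hl.ne'
  field_simp

/-- This turns the pair of bounds into a single norm, so that results on Banach spaces handle both
at once. -/
theorem norm_toTwoNorm_le_iff {l R : ℝ} (hl : 0 < l) (hR : 0 ≤ R) (w : L1) :
    ‖toTwoNorm l hl w‖ ≤ R ↔ MBound l R w := by
  have e : ‖toTwoNorm l hl w‖ = max ‖l • w‖ ‖l⁻¹ • inclInf w‖ := rfl
  rw [e, max_le_iff, MBound, norm_smul, norm_smul, ← L1.enorm_eq, Real.norm_of_nonneg hl.le,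
    Real.norm_of_nonneg (inv_nonneg.2 hl.le), inv_mul_le_iff₀ hl, ← le_div_iff₀' hl,
    ← ofReal_norm, ENNReal.ofReal_le_ofReal_iff (by positivity)]
  refine and_congr_right fun _ => ⟨fun h k => ?_, fun h => ?_⟩
  · rw [← ofReal_norm]
    refine ENNReal.ofReal_le_ofReal ?_
    rw [mul_comm]
    exact (lp.norm_apply_le_norm ENNReal.top_ne_zero (inclInf w) k).trans h
  · refine lp.norm_le_of_forall_le (by positivity) fun k => ?_
    have := h k
    rw [← ofReal_norm, ENNReal.ofReal_le_ofReal_iff (by positivity), mul_comm] at this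
    exact this

/-! ### Existence of integral curves -/

/-- At speed at most `ρ` a curve cannot leave the ball of radius `ρ` within unit time. The initial
time `t₀` is arbitrary so that the flow can also be solved backwards. -/
theorem exists_isCurve_of_norm_le {E : Type*} [NormedAddCommGroup E] [NormedSpace ℝ E]
    [CompleteSpace E] {V : E → E} (hV : LipOnBalls V) (x₀ : E) {ρ : ℝ} (hρ : 0 ≤ ρ)
    (hb : ∀ x ∈ Metric.closedBall x₀ ρ, ‖V x‖ ≤ ρ) (t₀ : Set.Icc (0 : ℝ) 1) :
    ∃ w : ℝ → E, IsCurve V w ∧ w t₀ = x₀ ∧ ∀ s, w s ∈ Metric.closedBall x₀ ρ := by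
  obtain ⟨K, hK⟩ := hV.lipschitzOnWith x₀ ρ
  lift ρ to NNReal using hρ
  have hm : (ρ : ℝ) * max (1 - (t₀ : ℝ)) ((t₀ : ℝ) - 0) ≤ ρ - (0 : NNReal) := by
    refine (mul_le_of_le_one_right ρ.2 (max_le ?_ ?_)).trans_eq (sub_zero _).symm <;> linarith [t₀.2.1, t₀.2.2]
  have hP : IsPicardLindelof (fun _ => V) t₀ x₀ ρ 0 ρ K :=
    IsPicardLindelof.of_time_independent hb hK hm
  have hx : x₀ ∈ Metric.closedBall x₀ ((0 : NNReal) : ℝ) := Metric.mem_closedBall_self le_rfl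
  -- The Picard fixed point itself is used because it comes with the information that the curve
  -- stays in the ball.
  obtain ⟨α, hα⟩ := ODE.FunSpace.exists_isFixedPt_next hP hx
  refine ⟨α.compProj, fun t ht => ?_, ?_, fun s => α.compProj_mem_closedBall hP.mul_max_le⟩
  · have := ODE.hasDerivWithinAt_picard_Icc t₀.2 hP.continuousOn_uncurry
      α.continuous_compProj.continuousOn (fun _ _ => α.compProj_mem_closedBall hP.mul_max_le)
      x₀ ht
    refine this.congr_of_mem (fun t' ht' => ?_) ht
    nth_rw 1 [← hα]
    rw [ODE.FunSpace.compProj_of_mem ht', ODE.FunSpace.next_apply]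
  · rw [ODE.FunSpace.compProj_val, ← hα, ODE.FunSpace.next_apply₀]

theorem exists_isCurve_of_mbound {V : L1 → L1} (hV : LipOnBalls V) {l C ρ : ℝ} (hl : 0 < l)
    (hC : 0 ≤ C) (hρ : 0 ≤ ρ) (hb : ∀ w : L1, MBound l (C + ρ) w → MBound l ρ (V w)) {v : L1}
    (hv : MBound l C v) (t₀ : Set.Icc (0 : ℝ) 1) :
    ∃ w : ℝ → L1, IsCurve V w ∧ w t₀ = v ∧ ∀ s, MBound l (C + ρ) (w s) := by
  have hball : ∀ x ∈ Metric.closedBall (toTwoNorm l hl v) ρ, MBound l (C + ρ) (ofTwoNorm l x) := by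
    intro x hx
    rw [← norm_toTwoNorm_le_iff hl (by positivity), toTwoNorm_ofTwoNorm]
    rw [mem_closedBall_iff_norm] at hx
    have := (norm_toTwoNorm_le_iff hl hC v).2 hv
    linarith [norm_le_norm_add_norm_sub' x (toTwoNorm l hl v)]
  obtain ⟨w, hw, hw0, hws⟩ := exists_isCurve_of_norm_le
    (hV.comp_clm (toTwoNorm l hl) (ofTwoNorm l)) (toTwoNorm l hl v) hρ
    (fun x hx => (norm_toTwoNorm_le_iff hl hρ _).2 (hb _ (hball x hx))) t₀
  refine ⟨fun s => ofTwoNorm l (w s), fun s hs => ?_, ?_, fun s => hball _ (hws s)⟩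
  · have := (ofTwoNorm l).hasFDerivAt.comp_hasDerivWithinAt s (hw s hs)
    rw [ofTwoNorm_toTwoNorm] at this
    exact this
  · change ofTwoNorm l (w t₀) = v
    rw [hw0, ofTwoNorm_toTwoNorm]

theorem IsCurve.mbound_sub {V : L1 → L1} {w : ℝ → L1} (hw : IsCurve V w) {l κ : ℝ} (hl : 0 < l)
    (hκ : 0 ≤ κ) (hb : ∀ s ∈ Set.Icc (0 : ℝ) 1, MBound l κ (V (w s))) :
    MBound l κ (w 1 - w 0 : L1) := by
  rw [← norm_toTwoNorm_le_iff hl hκ, map_sub]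
  have hd : ∀ s ∈ Set.Icc (0 : ℝ) 1, HasDerivWithinAt (fun s => toTwoNorm l hl (w s))
      (toTwoNorm l hl (V (w s))) (Set.Icc 0 1) s := fun s hs =>
    (toTwoNorm l hl).hasFDerivAt.comp_hasDerivWithinAt s (hw s hs)
  simpa using (convex_Icc (0 : ℝ) 1).norm_image_sub_le_of_norm_hasDerivWithin_le hd
    (fun s hs => (norm_toTwoNorm_le_iff hl hκ _).2 (hb s hs)) (Set.left_mem_Icc.2 zero_le_one)
    (Set.right_mem_Icc.2 zero_le_one)

/-! ### The sets `B^δ_{ε,C}` -/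

/-- The sequence `e^{δ|n|} v(n)`. -/
def weighted (δ : ℝ) (v : ℤ → ℂ) (k : ℤ) : ℂ := ((Real.exp (δ * |(k : ℝ)|) : ℝ) : ℂ) * v k

theorem ellNorm_one (δ : ℝ) (v : ℤ → ℂ) : ellNorm 1 δ v = ∑' k, ‖weighted δ v k‖ₑ := by
  rw [ellNorm, MeasureTheory.eLpNorm_one_eq_lintegral_enorm, MeasureTheory.lintegral_count]
  rfl

theorem ellNorm_top (δ : ℝ) (v : ℤ → ℂ) : ellNorm ∞ δ v = ⨆ k, ‖weighted δ v k‖ₑ := by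
  rw [ellNorm, MeasureTheory.eLpNorm_exponent_top, MeasureTheory.eLpNormEssSup_count]
  rfl

theorem ellNorm_eq {p : ℝ≥0∞} (hp : p ≠ 0) (hp' : p ≠ ∞) (δ : ℝ) (v : ℤ → ℂ) :
    ellNorm p δ v = (∑' k, ‖weighted δ v k‖ₑ ^ p.toReal) ^ (1 / p.toReal) := by
  rw [ellNorm, MeasureTheory.eLpNorm_eq_lintegral_rpow_enorm_toReal hp hp',
    MeasureTheory.lintegral_count]
  rfl

/-- For finite exponents `r`, the interpolation is `∑ |f| ^ r ≤ (sup |f|) ^ (r - 1) * ∑ |f|`, and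
the powers of `ε` match exactly. -/
theorem mem_B_iff {δ ε C : ℝ} (hε : 0 < ε) (hC : 0 ≤ C) (v : ℤ → ℂ) :
    v ∈ B δ ε C ↔ MBound (√ε) C (weighted δ v) := by
  have hl : 0 < √ε := Real.sqrt_pos.2 hε
  have hinv : (√ε)⁻¹ = ε ^ (-(1 / 2) : ℝ) := by
    rw [Real.sqrt_eq_rpow, ← Real.rpow_neg hε.le]
  have e1 : C * ε ^ ((1 / 2 : ℝ) - ((1 : ℝ≥0∞)⁻¹).toReal) = C / √ε := by
    rw [div_eq_mul_inv C, hinv]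
    norm_num
  have e2 : C * ε ^ ((1 / 2 : ℝ) - ((∞ : ℝ≥0∞)⁻¹).toReal) = C * √ε := by
    rw [Real.sqrt_eq_rpow]
    simp
  constructor
  · intro h
    have h1 := h 1 le_rfl
    have h2 := h ∞ le_top
    rw [e1, ellNorm_one] at h1
    rw [e2, ellNorm_top] at h2
    exact ⟨h1, iSup_le_iff.1 h2⟩
  · intro h p hp
    by_cases hpt : p = ∞
    · rw [hpt, e2, ellNorm_top]
      exact iSup_le h.2
    have hp0 : p ≠ 0 := (zero_lt_one.trans_le hp).ne'
    rw [ellNorm_eq hp0 hpt, ENNReal.toReal_inv]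
    have hr : 1 ≤ p.toReal := by
      have := ENNReal.toReal_mono hpt hp
      simpa using this
    set r := p.toReal
    have hr0 : 0 < r := by linarith
    have hsum : ∑' k, ‖weighted δ v k‖ₑ ^ r
        ≤ ENNReal.ofReal (C * √ε) ^ (r - 1) * ENNReal.ofReal (C / √ε) := by
      refine le_trans (ENNReal.tsum_le_tsum fun k => ?_)
        ((ENNReal.tsum_mul_left).trans_le (mul_le_mul_right h.1 _))
      calc ‖weighted δ v k‖ₑ ^ r = ‖weighted δ v k‖ₑ ^ (r - 1 + 1) := by rw [sub_add_cancel]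
        _ = ‖weighted δ v k‖ₑ ^ (r - 1) * ‖weighted δ v k‖ₑ := by
          rw [ENNReal.rpow_add_of_nonneg _ _ (by linarith) zero_le_one, ENNReal.rpow_one]
        _ ≤ _ := mul_le_mul' (ENNReal.rpow_le_rpow (h.2 k) (by linarith)) le_rfl
    refine (ENNReal.rpow_le_rpow hsum (by positivity)).trans (le_of_eq ?_)
    rw [ENNReal.ofReal_rpow_of_nonneg (by positivity) (by linarith),
      ← ENNReal.ofReal_mul (by positivity),
      ENNReal.ofReal_rpow_of_nonneg (by positivity) (by positivity)]
    congr 1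
    have e3 : (C * √ε) ^ (r - 1) * (C / √ε) = C ^ r * ε ^ (r / 2 - 1) := by
      rw [div_eq_mul_inv C, hinv, Real.mul_rpow hC hl.le, Real.sqrt_eq_rpow, ← Real.rpow_mul hε.le,
        mul_mul_mul_comm, ← Real.rpow_add hε]
      congr 1
      · nth_rw 2 [← Real.rpow_one C]
        rcases hC.eq_or_lt with rfl | hC
        · rw [Real.zero_rpow one_ne_zero, mul_zero, Real.zero_rpow hr0.ne']
        · rw [← Real.rpow_add hC, sub_add_cancel]
      · congr 1
        ring
    rw [e3, Real.mul_rpow (by positivity) (by positivity), ← Real.rpow_mul hC, ← Real.rpow_mul hε.le,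
      mul_one_div_cancel hr0.ne', Real.rpow_one]
    congr 2
    field_simp

/-! ### Passage between the weighted and the unweighted flow -/

theorem weighted_sub (δ : ℝ) (v u : ℤ → ℂ) : weighted δ (v - u) = weighted δ v - weighted δ u :=
  funext fun _ => mul_sub _ _ _

theorem exp_neg_mul_weighted (δ : ℝ) (v : ℤ → ℂ) (k : ℤ) :
    (Real.exp (-(δ * |(k : ℝ)|)) : ℂ) * weighted δ v k = v k := by
  rw [weighted, ← mul_assoc, ← Complex.ofReal_mul, ← Real.exp_add, neg_add_cancel, Real.exp_zero,
    Complex.ofReal_one, one_mul]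

theorem enorm_exp_neg_mul_le {δ : ℝ} (hδ : 0 ≤ δ) (z : ℂ) (k : ℤ) :
    ‖(Real.exp (-(δ * |(k : ℝ)|)) : ℂ) * z‖ₑ ≤ ‖z‖ₑ := by
  rw [enorm_mul]
  refine mul_le_of_le_one_left' ?_
  rw [← ofReal_norm, Complex.norm_real, Real.norm_of_nonneg (Real.exp_nonneg _)]
  exact ENNReal.ofReal_le_one.2 (Real.exp_le_one_iff.2 (neg_nonpos.2 (by positivity)))

/-- Multiplication by `e^{-δ|k|}` on `ℓ¹`. -/
def unweight {δ : ℝ} (hδ : 0 ≤ δ) : L1 →L[ℝ] L1 :=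
  LinearMap.mkContinuous
    { toFun := fun w => ⟨fun k => (Real.exp (-(δ * |(k : ℝ)|)) : ℂ) * w k,
        memℓp_one_of_tsum_enorm (ne_top_of_le_ne_top (by rw [← L1.enorm_eq]; exact enorm_ne_top)
          (ENNReal.tsum_le_tsum fun k => enorm_exp_neg_mul_le hδ (w k) k))⟩
      map_add' := fun x y => lp.ext (funext fun k => mul_add _ (x k) (y k))
      map_smul' := fun a x => lp.ext (funext fun k => mul_smul_comm a _ (x k)) } 1 fun w => by
    rw [one_mul, ← toReal_enorm, ← toReal_enorm w]
    refine ENNReal.toReal_mono enorm_ne_top ?_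
    rw [L1.enorm_eq, L1.enorm_eq]
    exact ENNReal.tsum_le_tsum fun k => enorm_exp_neg_mul_le hδ (w k) k

theorem unweight_apply {δ : ℝ} (hδ : 0 ≤ δ) (w : L1) (k : ℤ) :
    unweight hδ w k = (Real.exp (-(δ * |(k : ℝ)|)) : ℂ) * w k := rfl

theorem unweight_eq {δ : ℝ} (hδ : 0 ≤ δ) {w : L1} {v : ℤ → ℂ} (h : ⇑w = weighted δ v) :
    ⇑(unweight hδ w) = v := by
  funext k
  rw [unweight_apply, h, exp_neg_mul_weighted]

theorem weighted_unweight {δ : ℝ} (hδ : 0 ≤ δ) (w : L1) : weighted δ (unweight hδ w) = w := by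
  funext k
  rw [weighted, unweight_apply, ← mul_assoc, ← Complex.ofReal_mul, ← Real.exp_add,
    add_neg_cancel, Real.exp_zero, Complex.ofReal_one, one_mul]

/-! ### Confinement of a single flow. -/

section Step

variable {n : ℕ} {σ : Fin (n + 1) → Bool} {c : (Fin (n + 1) → ℤ) → ℝ}

theorem IsCoeff.isCurve_unweight (h : IsCoeff σ c) {δ : ℝ} (hδ : 0 ≤ δ) {w : ℝ → L1}
    (hw : IsCurve (h.weightedField hδ) w) :
    IsCurve (h.weightedField le_rfl) fun s => unweight hδ (w s) := fun s hs => by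
  have e : h.weightedField le_rfl (unweight hδ (w s)) = unweight hδ (h.weightedField hδ (w s)) := by
    refine lp.ext (funext fun k => ?_)
    rw [h.weightedField_zero_apply, unweight_apply, ← h.field_eq]
    rfl
  beta_reduce
  rw [e]
  exact (unweight hδ).hasFDerivAt.comp_hasDerivWithinAt s (hw s hs)

/-- The estimate under which the flow moves sequences with bound `C` by at most `ρ`. -/
def IsCoeff.Confined (h : IsCoeff σ c) {δ : ℝ} (hδ : 0 ≤ δ) (ε C ρ : ℝ) : Prop :=
  ∀ w : L1, MBound (√ε) (C + ρ) w → MBound (√ε) ρ (h.weightedField hδ w)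

variable {h : IsCoeff σ c} {δ : ℝ} {hδ : 0 ≤ δ} {ε C ρ : ℝ}

theorem IsCoeff.Confined.exists_curve (hc : h.Confined hδ ε C ρ) (hε : 0 < ε) (hC : 0 ≤ C)
    (hρ : 0 ≤ ρ) {v : ℤ → ℂ} (hv : v ∈ B δ ε C) (t₀ : Set.Icc (0 : ℝ) 1) :
    ∃ w : ℝ → L1, IsCurve (h.weightedField hδ) w ∧ ⇑(w t₀) = weighted δ v ∧
      ∀ s, MBound (√ε) (C + ρ) (w s) := by
  have hb := (mem_B_iff hε hC v).1 hv
  obtain ⟨w, hw, hw0, hws⟩ := exists_isCurve_of_mbound (h.lipOnBalls_weightedField hδ)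
    (Real.sqrt_pos.2 hε) hC hρ hc
    (v := ⟨weighted δ v, memℓp_one_of_tsum_enorm (ne_top_of_le_ne_top ENNReal.ofReal_ne_top hb.1)⟩)
    hb t₀
  exact ⟨w, hw, by rw [hw0], hws⟩

theorem IsCoeff.Confined.exists_timeOne (hc : h.Confined hδ ε C ρ) (hε : 0 < ε) (hC : 0 ≤ C)
    (hρ : 0 ≤ ρ) {v : ℤ → ℂ} (hv : v ∈ B δ ε C) :
    ∃ u, TimeOne (fun v => ham σ c v - conj (ham σ c v)) v u := by
  obtain ⟨w, hw, hw0, -⟩ := hc.exists_curve hε hC hρ hv ⟨0, Set.left_mem_Icc.2 zero_le_one⟩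
  exact ⟨_, (timeOne_iff h _ _).2 ⟨_, h.isCurve_unweight hδ hw, unweight_eq hδ hw0, rfl⟩⟩

theorem IsCoeff.Confined.exists_timeOne_symm (hc : h.Confined hδ ε C ρ) (hε : 0 < ε) (hC : 0 ≤ C)
    (hρ : 0 ≤ ρ) {u : ℤ → ℂ} (hu : u ∈ B δ ε C) :
    ∃ v, TimeOne (fun v => ham σ c v - conj (ham σ c v)) v u := by
  obtain ⟨w, hw, hw1, -⟩ := hc.exists_curve hε hC hρ hu ⟨1, Set.right_mem_Icc.2 zero_le_one⟩
  exact ⟨_, (timeOne_iff h _ _).2 ⟨_, h.isCurve_unweight hδ hw, rfl, unweight_eq hδ hw1⟩⟩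

/-- The solution behind `TimeOne` is known only in unweighted `ℓ¹`. Uniqueness there, from whichever
end lies in `B δ ε C`, identifies its endpoints with those of the confined weighted solution. -/
theorem IsCoeff.Confined.curve_of_timeOne (hc : h.Confined hδ ε C ρ) (hε : 0 < ε) (hC : 0 ≤ C)
    (hρ : 0 ≤ ρ) {v u : ℤ → ℂ} (hvu : TimeOne (fun v => ham σ c v - conj (ham σ c v)) v u)
    (hB : v ∈ B δ ε C ∨ u ∈ B δ ε C) :
    ∃ w : ℝ → L1, IsCurve (h.weightedField hδ) w ∧ ⇑(w 0) = weighted δ v ∧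
      ⇑(w 1) = weighted δ u ∧ ∀ s, MBound (√ε) (C + ρ) (w s) := by
  rcases hB with hB | hB
  · obtain ⟨w, hw, hw0, hws⟩ := hc.exists_curve hε hC hρ hB ⟨0, Set.left_mem_Icc.2 zero_le_one⟩
    have := timeOne_unique h hvu
      ((timeOne_iff h _ _).2 ⟨_, h.isCurve_unweight hδ hw, unweight_eq hδ hw0, rfl⟩)
    exact ⟨w, hw, hw0, by rw [this, weighted_unweight], hws⟩
  · obtain ⟨w, hw, hw1, hws⟩ := hc.exists_curve hε hC hρ hB ⟨1, Set.right_mem_Icc.2 zero_le_one⟩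
    have := timeOne_injective h hvu
      ((timeOne_iff h _ _).2 ⟨_, h.isCurve_unweight hδ hw, rfl, unweight_eq hδ hw1⟩)
    exact ⟨w, hw, by rw [this, weighted_unweight], hw1, hws⟩

theorem IsCoeff.Confined.mem_B (hc : h.Confined hδ ε C ρ) (hε : 0 < ε) (hC : 0 ≤ C)
    (hρ : 0 ≤ ρ) {v u : ℤ → ℂ} (hvu : TimeOne (fun v => ham σ c v - conj (ham σ c v)) v u)
    (hB : v ∈ B δ ε C ∨ u ∈ B δ ε C) : v ∈ B δ ε (C + ρ) ∧ u ∈ B δ ε (C + ρ) := by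
  obtain ⟨w, -, h0, h1, hws⟩ := hc.curve_of_timeOne hε hC hρ hvu hB
  rw [mem_B_iff hε (by positivity), mem_B_iff hε (by positivity), ← h0, ← h1]
  exact ⟨hws 0, hws 1⟩

theorem IsCoeff.Confined.mbound_sub (hc : h.Confined hδ ε C ρ) (hε : 0 < ε) (hC : 0 ≤ C)
    (hρ : 0 ≤ ρ) {v u : ℤ → ℂ} (hvu : TimeOne (fun v => ham σ c v - conj (ham σ c v)) v u)
    (hB : v ∈ B δ ε C ∨ u ∈ B δ ε C) {κ : ℝ} (hκ : 0 ≤ κ)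
    (hb : ∀ w : L1, MBound (√ε) (C + ρ) w → MBound (√ε) κ (h.weightedField hδ w)) :
    MBound (√ε) κ (weighted δ (u - v)) := by
  obtain ⟨w, hw, h0, h1, hws⟩ := hc.curve_of_timeOne hε hC hρ hvu hB
  rw [weighted_sub, ← h0, ← h1]
  exact hw.mbound_sub (Real.sqrt_pos.2 hε) hκ fun s _ => hb _ (hws s)

end Step

theorem IsCoeff.exists_confined {p : ℕ} {σ : Fin (2 * p + 3 + 1) → Bool}
    {c : (Fin (2 * p + 3 + 1) → ℤ) → ℝ} (h : IsCoeff σ c) (hd : Dispersive c p) {C ρ : ℝ}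
    (hC : 0 ≤ C) (hρ : 0 < ρ) :
    ∃ ε₀ ∈ Set.Ioo (0 : ℝ) 1, ∀ ε ∈ Set.Ioo (0 : ℝ) ε₀, ∀ (δ : ℝ) (hδ : 0 ≤ δ),
      h.Confined hδ ε C ρ := by
  -- The loss `γ = 1 / 2` leaves the bound `M * √ε` on the field, which is at most `ρ` for small
  -- `ε`. Thus the threshold does not depend on the `γ` of the final estimate.
  obtain ⟨K, hK, hb⟩ := h.exists_field_bound hd (γ := 1 / 2) (by norm_num)
  set M := K * (C + ρ) ^ (2 * p + 3)
  have hM : 0 ≤ M := by positivity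
  refine ⟨min (1 / 2) ((ρ / (M + 1)) ^ 2), ⟨by positivity, by
    exact (min_le_left _ _).trans_lt (by norm_num)⟩, fun ε hε δ hδ w hw => ?_⟩
  have h1 : ε < 1 := hε.2.trans ((min_le_left _ _).trans_lt (by norm_num))
  have h2 : √ε ≤ ρ / (M + 1) :=
    (Real.sqrt_le_left (by positivity)).2 (hε.2.le.trans (min_le_right _ _))
  refine (hb ε ⟨hε.1, h1⟩ δ hδ (C + ρ) (by positivity) w hw).mono (Real.sqrt_pos.2 hε.1) ?_
  rw [show (1 : ℝ) - 1 / 2 = 1 / 2 by norm_num, ← Real.sqrt_eq_rpow, mul_right_comm]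
  calc M * √ε ≤ (M + 1) * (ρ / (M + 1)) := by gcongr; linarith
    _ = ρ := by field_simp

theorem MBound.add {l R R' : ℝ} (hl : 0 < l) (hR : 0 ≤ R) (hR' : 0 ≤ R') {w w' : ℤ → ℂ}
    (h : MBound l R w) (h' : MBound l R' w') : MBound l (R + R') (w + w') := by
  constructor
  · rw [add_div, ENNReal.ofReal_add (by positivity) (by positivity)]
    refine le_trans ?_ (add_le_add h.1 h'.1)
    rw [← ENNReal.tsum_add]
    exact ENNReal.tsum_le_tsum fun k => enorm_add_le _ _
  · intro k
    rw [add_mul, ENNReal.ofReal_add (by positivity) (by positivity)]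
    exact (enorm_add_le _ _).trans (add_le_add (h.2 k) (h'.2 k))

theorem canonical_iff (v u : ℤ → ℂ) : Canonical v u ↔ ∃ z : ℤ → ℂ,
    TimeOne (fun v => ham sexticFlag sexticCoeff v - conj (ham sexticFlag sexticCoeff v)) v z ∧
    TimeOne (fun v => ham quarticFlag quarticCoeff v - conj (ham quarticFlag quarticCoeff v)) z u := by
  rw [← F₁_eq, ← F₂_eq, Canonical]

end QuasiLinearNLS

end

/-! ### Composition of the two flows. -/

open QuasiLinearNLS in
theorem proposition1 :
    -- the transformation is single-valued and injective
    (∀ v u u' : ℤ → ℂ, Canonical v u → Canonical v u' → u = u') ∧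
    (∀ v v' u : ℤ → ℂ, Canonical v u → Canonical v' u → v = v') ∧
    -- it preserves the `ℓ²` norm
    (∀ v u : ℤ → ℂ, Canonical v u → ellNorm 2 0 u = ellNorm 2 0 v) ∧
    ∀ C : ℝ, 0 < C → ∃ ε₀ ∈ Set.Ioo (0 : ℝ) 1,
      -- it is defined on `B^δ_{ε,C}`, and its range contains `B^δ_{ε,C}`
      (∀ δ : ℝ, 0 < δ → ∀ ε ∈ Set.Ioo (0 : ℝ) ε₀,
        (∀ v ∈ B δ ε C, ∃ u, Canonical v u) ∧ (∀ u ∈ B δ ε C, ∃ v, Canonical v u)) ∧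
      -- it is near-identical
      (∀ p : ℝ≥0∞, 1 ≤ p → ∀ γ : ℝ, 0 < γ → ∃ K : ℝ,
        ∀ δ : ℝ, 0 < δ → ∀ ε ∈ Set.Ioo (0 : ℝ) ε₀, ∀ v u : ℤ → ℂ, Canonical v u →
          (u ∈ B δ ε C ∨ v ∈ B δ ε C) →
            ellNorm p δ (u - v)
              ≤ ENNReal.ofReal (K * ε ^ ((3 / 2 : ℝ) - (p⁻¹).toReal - γ))) ∧
      -- it and its inverse map `B^δ_{ε,C}` into `B^δ_{ε,2C}`
      (∀ δ : ℝ, 0 < δ → ∀ ε ∈ Set.Ioo (0 : ℝ) ε₀, ∀ v u : ℤ → ℂ, Canonical v u →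
        (u ∈ B δ ε C → v ∈ B δ ε (2 * C)) ∧ (v ∈ B δ ε C → u ∈ B δ ε (2 * C))) := by
  simp only [canonical_iff]
  refine ⟨?_, ?_, ?_, fun C hC => ?_⟩
  · rintro v u u' ⟨z, hvz, hzu⟩ ⟨z', hvz', hzu'⟩
    obtain rfl := timeOne_unique isCoeff_sextic hvz hvz'
    exact timeOne_unique isCoeff_quartic hzu hzu'
  · rintro v v' u ⟨z, hvz, hzu⟩ ⟨z', hvz', hzu'⟩
    obtain rfl := timeOne_injective isCoeff_quartic hzu hzu'
    exact timeOne_injective isCoeff_sextic hvz hvz'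
  · rintro v u ⟨z, hvz, hzu⟩
    rw [timeOne_ellNorm_two isCoeff_quartic hzu, timeOne_ellNorm_two isCoeff_sextic hvz]
  -- Each flow may enlarge the constant by `C / 2`: from `C` to `3C/2` at the intermediate point,
  -- then to `2C`.
  have hC2 : 0 < C / 2 := by positivity
  have hCC : 0 ≤ C + C / 2 := by positivity
  have hC' : C + C / 2 + C / 2 = 2 * C := by ring
  -- smallness of the two flows on `B^δ_{ε,3C/2}`, which contains `B^δ_{ε,C}`
  obtain ⟨ε₁, hε₁, h₁⟩ :=
    (isCoeff_quartic.exists_confined (p := 0) dispersive_quarticCoeff hC.le hC2)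
  obtain ⟨ε₂, hε₂, h₂⟩ :=
    (isCoeff_quartic.exists_confined (p := 0) dispersive_quarticCoeff hCC hC2)
  obtain ⟨ε₃, hε₃, h₃⟩ :=
    (isCoeff_sextic.exists_confined (p := 1) dispersive_sexticCoeff hC.le hC2)
  obtain ⟨ε₄, hε₄, h₄⟩ :=
    (isCoeff_sextic.exists_confined (p := 1) dispersive_sexticCoeff hCC hC2)
  have hlt : ∀ ε ∈ Set.Ioo (0 : ℝ) (min (min ε₁ ε₂) (min ε₃ ε₄)),
      ε ∈ Set.Ioo 0 ε₁ ∧ ε ∈ Set.Ioo 0 ε₂ ∧ ε ∈ Set.Ioo 0 ε₃ ∧ ε ∈ Set.Ioo 0 ε₄ := by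
    rintro ε ⟨h0, h⟩
    simp only [lt_min_iff] at h
    exact ⟨⟨h0, h.1.1⟩, ⟨h0, h.1.2⟩, ⟨h0, h.2.1⟩, ⟨h0, h.2.2⟩⟩
  refine ⟨min (min ε₁ ε₂) (min ε₃ ε₄), ⟨lt_min (lt_min hε₁.1 hε₂.1) (lt_min hε₃.1 hε₄.1),
    ((min_le_left _ _).trans (min_le_left _ _)).trans_lt hε₁.2⟩, ?_, ?_, ?_⟩
  · intro δ hδ ε hε
    obtain ⟨i₁, i₂, i₃, i₄⟩ := hlt ε hε
    refine ⟨fun v hv => ?_, fun u hu => ?_⟩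
    · obtain ⟨z, hz⟩ := (h₃ ε i₃ δ hδ.le).exists_timeOne hε.1 hC.le hC2.le hv
      obtain ⟨u, hu⟩ := (h₂ ε i₂ δ hδ.le).exists_timeOne hε.1 hCC hC2.le
        ((h₃ ε i₃ δ hδ.le).mem_B hε.1 hC.le hC2.le hz (.inl hv)).2
      exact ⟨u, z, hz, hu⟩
    · obtain ⟨z, hz⟩ := (h₁ ε i₁ δ hδ.le).exists_timeOne_symm hε.1 hC.le hC2.le hu
      obtain ⟨v, hv⟩ := (h₄ ε i₄ δ hδ.le).exists_timeOne_symm hε.1 hCC hC2.le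
        ((h₁ ε i₁ δ hδ.le).mem_B hε.1 hC.le hC2.le hz (.inr hu)).1
      exact ⟨v, z, hv, hz⟩
  · intro p hp γ hγ
    obtain ⟨K₁, hK₁, b₁⟩ :=
      (isCoeff_quartic.exists_field_bound (p := 0) dispersive_quarticCoeff hγ)
    obtain ⟨K₂, hK₂, b₂⟩ :=
      (isCoeff_sextic.exists_field_bound (p := 1) dispersive_sexticCoeff hγ)
    -- Both curves keep the bound `2 * C`; the exponents `5` and `3` are the degrees of the two
    -- vector fields.
    refine ⟨K₂ * (2 * C) ^ (2 * 1 + 3) + K₁ * (2 * C) ^ (2 * 0 + 3), ?_⟩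
    rintro δ hδ ε hε v u ⟨z, hvz, hzu⟩ hB
    obtain ⟨i₁, i₂, i₃, i₄⟩ := hlt ε hε
    have hε1 : ε ∈ Set.Ioo (0 : ℝ) 1 := ⟨hε.1, i₁.2.trans hε₁.2⟩
    have hl := Real.sqrt_pos.2 hε.1
    have hεγ : 0 ≤ ε ^ (1 - γ) := Real.rpow_nonneg hε.1.le _
    -- Whichever end is controlled, so is the intermediate point; both displacements are then
    -- estimated from `z`.
    have hz : z ∈ B δ ε (C + C / 2) := by
      rcases hB with hB | hB
      · exact ((h₁ ε i₁ δ hδ.le).mem_B hε.1 hC.le hC2.le hzu (.inr hB)).1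
      · exact ((h₃ ε i₃ δ hδ.le).mem_B hε.1 hC.le hC2.le hvz (.inl hB)).2
    have d₁ := (h₂ ε i₂ δ hδ.le).mbound_sub hε.1 hCC hC2.le hzu (.inl hz)
      (κ := K₁ * ε ^ (1 - γ) * (2 * C) ^ (2 * 0 + 3)) (by positivity)
      (by rw [hC']; exact b₁ ε hε1 δ hδ.le _ (by positivity))
    have d₂ := (h₄ ε i₄ δ hδ.le).mbound_sub hε.1 hCC hC2.le hvz (.inr hz)
      (κ := K₂ * ε ^ (1 - γ) * (2 * C) ^ (2 * 1 + 3)) (by positivity)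
      (by rw [hC']; exact b₂ ε hε1 δ hδ.le _ (by positivity))
    have d := d₂.add hl (by positivity) (by positivity) d₁
    have e : weighted δ (z - v) + weighted δ (u - z) = weighted δ (u - v) := by
      simp only [weighted_sub]
      abel
    -- The displacement lies in a set `B` whose constant carries the factor `ε ^ (1 - γ)`, which
    -- gives all exponents `p` at once.
    rw [e, ← mem_B_iff hε.1 (by positivity)] at d
    refine (d p hp).trans_eq ?_
    rw [show (3 / 2 : ℝ) - (p⁻¹).toReal - γ = (1 - γ) + (1 / 2 - (p⁻¹).toReal) by ring,
      Real.rpow_add hε.1]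
    congr 1
    ring
  · rintro δ hδ ε hε v u ⟨z, hvz, hzu⟩
    obtain ⟨i₁, i₂, i₃, i₄⟩ := hlt ε hε
    rw [← hC']
    refine ⟨fun hu => ?_, fun hv => ?_⟩
    · exact ((h₄ ε i₄ δ hδ.le).mem_B hε.1 hCC hC2.le hvz
        (.inr ((h₁ ε i₁ δ hδ.le).mem_B hε.1 hC.le hC2.le hzu (.inr hu)).1)).1
    · exact ((h₂ ε i₂ δ hδ.le).mem_B hε.1 hCC hC2.le hzu
        (.inl ((h₃ ε i₃ δ hδ.le).mem_B hε.1 hC.le hC2.le hvz (.inl hv)).2)).2
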